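/- Identify $\mathbf R^2_+=\{(t,x):t>0\}$ with the upper half-plane $\{z=x+it:\operatorname{Im}z>0\}$. For an open interval $Q=(a,b)$ put $|Q|=\ell(Q)=b-a$ and $Q^{\rm ca}=(0,\ell(Q))\times Q$, $Q^w=(\ell(Q)/2,\ell(Q))\times Q$. Let $$CF(x)=\sup_{Q\ni x}\frac1{|Q|}\iint_{Q^{\rm ca}}|F|\,dt\,dy,\qquad W_qf(t,x)=|Q^w|^{-1/q}\|f\|_{L_q(Q^w)},$$ where the supremum is over all bounded open intervals $Q\ni x$, and in $W_q f(t,x)$ the interval $Q$ has centre $x$ and length $t$. Let $$Sf(z)=\lim_{\varepsilon\to0^+}\frac{-1}{\pi}\int_{\operatorname{Im}w>0,\ |w-z|>\varepsilon}\frac{f(w)}{(w-z)^2}\,dA(w)$$ be the Beurling transform on the upper half-plane ($dA$ is area measure), and for real $g$ on $\mathbf R$ let $u(t,x)=\frac1\pi\int_{\mathbf R}\frac{t\,g(y)}{(x-y)^2+t^2}\,dy$ be its Poisson extension. If $f$ is a smooth complex function with compact support in the open upper half-plane, the limit $Sf(z)$ exists for every $z$ with $\operatorname{Im}z>0$. Moreover,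 for all $1<p,q<\infty$: 1. $S$ is not bounded in the norm $\|C(W_qf)\|_p$: there is no constant $c<\infty$ with $\|C(W_q(Sf))\|_p\le c\,\|C(W_qf)\|_p$ for all $f\in C_c^\infty(\mathbf R^2_+;\mathbf C)$. 2. There is no $c<\infty$ with $\|C(Sf)\|_p\le c\,\|C(W_qf)\|_p$ for all $f\in C_c^\infty(\mathbf R^2_+;\mathbf C)$. 3. There is no $c<\infty$ with $\|C(\nabla u)\|_p\le c\,\|g\|_p$ for all real $g\in C_c^\infty(\mathbf R)$. 4. There is no $c<\infty$ with $\int_0^1\|\partial_tu(t,\cdot)\|_{L_1(0,1)}\,dt\le c\,\|g\|_p$ for all real $g\in C_c^\infty(\mathbf R)$. 5. There is no $c<\infty$ with $\int_0^1\max_k\|\partial_tu_k(t,\cdot)\|_{L_1(0,1)}\,dt\le c\,\big\|\big(\sum_k|g_k|^2\big)^{1/2}\big\|_p$ for all finite families of real $g_k\in C_c^\infty(\mathbf R)$ with Poisson extensions $u_k$. Consequently these estimates also fail on every larger class of functions. -/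

import Mathlib

open scoped ENNReal NNReal Topology ContDiff

noncomputable section

namespace BeurlingCarleson

/-- The open upper half-plane as a subset of `ℂ`; the point `(t, x)` of `ℝ²₊` is `x + i t`. -/
def halfPlane : Set ℂ := {z | 0 < z.im}

/-- Smooth complex-valued functions with compact support in the open upper half-plane. -/
def IsTest (f : ℂ → ℂ) : Prop :=
  ContDiff ℝ ∞ f ∧ HasCompactSupport f ∧ tsupport f ⊆ halfPlane

/-- The Carleson square `Q^ca = (0, ℓ(Q)) × Q` over the interval `Q = (a, b)`. -/
def carlesonBox (a b : ℝ) : Set ℂ := Set.Ioo a b ×ℂ Set.Ioo 0 (b - a)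

/-- The Whitney region `Q^w = (t/2, t) × Q`, where `Q` is the interval with centre `x` and
length `t`, and `z = x + i t`. -/
def whitneyRegion (z : ℂ) : Set ℂ :=
  Set.Ioo (z.re - z.im / 2) (z.re + z.im / 2) ×ℂ Set.Ioo (z.im / 2) z.im

/-- The Carleson functional `C F(x) = sup_{Q ∋ x} |Q|⁻¹ ∬_{Q^ca} F` of a nonnegative function. -/
def carleson (F : ℂ → ℝ≥0∞) (x : ℝ) : ℝ≥0∞ :=
  ⨆ (a : ℝ) (b : ℝ) (_ : x ∈ Set.Ioo a b),
    (ENNReal.ofReal (b - a))⁻¹ * ∫⁻ z in carlesonBox a b, F z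

/-- The Whitney average `W_q f(t, x) = |Q^w|^{-1/q} ‖f‖_{L_q(Q^w)}`. -/
def whitneyAverage (q : ℝ) (f : ℂ → ℂ) (z : ℂ) : ℝ≥0∞ :=
  MeasureTheory.volume (whitneyRegion z) ^ (-1 / q) *
    MeasureTheory.eLpNorm f (ENNReal.ofReal q)
      (MeasureTheory.volume.restrict (whitneyRegion z))

/-- The `L_p(ℝ)` norm of a nonnegative, possibly infinite, function. -/
def lpNorm (p : ℝ) (h : ℝ → ℝ≥0∞) : ℝ≥0∞ := (∫⁻ x, h x ^ p) ^ (1 / p)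

/-- The norm `‖C(W_q f)‖_p`. -/
def carlesonNorm (p q : ℝ) (f : ℂ → ℂ) : ℝ≥0∞ :=
  lpNorm p (carleson (whitneyAverage q f))

/-- The truncated Beurling integral over `{Im w > 0, |w - z| > ε}`, with respect to area. -/
def beurlingTrunc (f : ℂ → ℂ) (ε : ℝ) (z : ℂ) : ℂ :=
  -1 / (Real.pi : ℂ) * ∫ w in {w : ℂ | w ∈ halfPlane ∧ ε < ‖w - z‖}, f w / (w - z) ^ 2

/-- The Beurling transform on the upper half-plane, as a principal value. -/
def beurling (f : ℂ → ℂ) (z : ℂ) : ℂ :=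
  Filter.limUnder (𝓝[>] (0 : ℝ)) fun ε => beurlingTrunc f ε z

/-- The Poisson extension `u(t, x) = π⁻¹ ∫ t g(y) / ((x - y)² + t²) dy`, at `z = x + i t`. -/
def poisson (g : ℝ → ℝ) (z : ℂ) : ℝ :=
  1 / Real.pi * ∫ y : ℝ, z.im / ((z.re - y) ^ 2 + z.im ^ 2) * g y

/-- The transversal derivative `∂_t u(t, x)` of the Poisson extension `u` of `g`. -/
def poissonDt (g : ℝ → ℝ) (t x : ℝ) : ℝ :=
  deriv (fun s : ℝ => poisson g ⟨x, s⟩) t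

/-- `‖∂_t u(t, ·)‖_{L_1(0,1)}` for the Poisson extension `u` of `g`. -/
def poissonDtL1 (g : ℝ → ℝ) (t : ℝ) : ℝ≥0∞ :=
  ∫⁻ x in Set.Ioo (0 : ℝ) 1, ‖poissonDt g t x‖ₑ

end BeurlingCarleson

end

noncomputable section

namespace BeurlingCarleson

open MeasureTheory Set Filter

/-! All five estimates fail because smooth `g` with `|g| ≤ 2` and support in `[-2, 2]` can have
Poisson extensions with arbitrarily large variation `∫₀¹∫₀¹ |∂_t u| dx dt`
(`exists_large_poissonVariation`).

A fast cosine has boundary values of `L₁` size at least `1/2`, while by Riemann–Lebesgue its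
extension is negligible at any fixed height. Hence it has a definite amount of variation below that
height, most of it in a strip away from the boundary. Iteration gives frequencies and disjoint
strips, each strip carrying variation at least `1/8` of its own cosine. The sum of `N` such cosines
scaled by `c_k = N^{-1/2} cos` need not be bounded, so it is replaced by `Im ∏ (1 ± i c_k)`, of
modulus at most `(1 + 1/N)^{N/2} < 2`. Averaging over the signs against the `j`-th sign returns
exactly `c_j`, so the mean variation over the `j`-th strip is at least `N^{-1/2}/8`. Summed over the
`N` strips this is `√N/8`, and some choice of signs attains it.

The variation is dominated by the left sides of the Poisson estimates. For `S`, the function `g` is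
spread over a layer of thickness `δ` near the boundary. The norms `‖C(W_q f)‖_p` of the layers are
bounded uniformly in `g` and `δ`, whereas `Sf` tends to `-π⁻¹ ∫ g(y)/(y - z)² dy`, whose real part
is `-∂_t u`. Fatou's lemma carries the blow-up over to `Sf`. -/

/-! ### The Poisson extension as the imaginary part of a Cauchy integral -/

/-- The derivative `∫ g(y) / (y - z)² dy` of the Cauchy integral of `g`. -/
def cauchyDeriv (g : ℝ → ℝ) (z : ℂ) : ℂ := ∫ y : ℝ, (g y : ℂ) / ((y : ℂ) - z) ^ 2

theorem ofReal_sub_ne_zero {z : ℂ} (hz : 0 < z.im) (y : ℝ) : (y : ℂ) - z ≠ 0 := by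
  intro h
  have := congrArg Complex.im h
  simp at this
  exact hz.ne' this

theorem integrable_div_ofReal_sub_pow {g : ℝ → ℝ} (hg : Continuous g) (hs : HasCompactSupport g)
    {z : ℂ} (hz : 0 < z.im) (n : ℕ) :
    Integrable (fun y : ℝ => (g y : ℂ) / ((y : ℂ) - z) ^ n) := by
  apply Continuous.integrable_of_hasCompactSupport
  · have h : ∀ y : ℝ, ((y : ℂ) - z) ^ n ≠ 0 := fun y => pow_ne_zero _ (ofReal_sub_ne_zero hz y)
    fun_prop (disch := exact h _)
  · refine hs.mono fun y hy => ?_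
    simp only [Function.mem_support] at hy ⊢
    rintro h
    simp [h] at hy

theorem im_le_norm_ofReal_sub (z : ℂ) (y : ℝ) : z.im ≤ ‖(y : ℂ) - z‖ := by
  have := Complex.abs_im_le_norm ((y : ℂ) - z)
  simp only [Complex.sub_im, Complex.ofReal_im, zero_sub, abs_neg] at this
  exact (le_abs_self _).trans this

theorem hasDerivAt_cauchy {g : ℝ → ℝ} (hg : Continuous g) (hs : HasCompactSupport g)
    {z : ℂ} (hz : 0 < z.im) :
    HasDerivAt (fun z : ℂ => ∫ y : ℝ, (g y : ℂ) / ((y : ℂ) - z)) (cauchyDeriv g z) z := by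
  have hU : {w : ℂ | z.im / 2 < w.im} ∈ 𝓝 z :=
    (isOpen_lt continuous_const Complex.continuous_im).mem_nhds (by simp; linarith)
  have hU' : ∀ w ∈ {w : ℂ | z.im / 2 < w.im}, 0 < w.im := fun w hw => by
    simp at hw; linarith
  refine (hasDerivAt_integral_of_dominated_loc_of_deriv_le
    (F := fun (w : ℂ) (y : ℝ) => (g y : ℂ) / ((y : ℂ) - w))
    (F' := fun (w : ℂ) (y : ℝ) => (g y : ℂ) / ((y : ℂ) - w) ^ 2)
    (bound := fun y => |g y| / (z.im / 2) ^ 2) hU ?_ ?_ ?_ ?_ ?_ ?_).2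
  · filter_upwards [hU] with w hw
    simpa using (integrable_div_ofReal_sub_pow hg hs (hU' w hw) 1).aestronglyMeasurable
  · simpa using integrable_div_ofReal_sub_pow hg hs hz 1
  · exact (integrable_div_ofReal_sub_pow hg hs hz 2).aestronglyMeasurable
  · refine ae_of_all _ fun y w hw => ?_
    simp only [norm_div, norm_pow, Complex.norm_real, Real.norm_eq_abs]
    have h1 := im_le_norm_ofReal_sub w y
    have h2 : z.im / 2 ≤ ‖(y : ℂ) - w‖ := by simp at hw; linarith
    gcongr
  · exact (hg.abs.integrable_of_hasCompactSupport hs.abs).div_const _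
  · refine ae_of_all _ fun y w hw => ?_
    have h := ofReal_sub_ne_zero (hU' w hw) y
    have h1 : HasDerivAt (fun w : ℂ => (y : ℂ) - w) (-1) w := by
      simpa using (hasDerivAt_id w).const_sub (y : ℂ)
    have h2 := (h1.inv h).const_mul (g y : ℂ)
    simp only [neg_neg] at h2
    convert! h2 using 1
    field_simp

theorem poisson_eq_im {g : ℝ → ℝ} (hg : Continuous g) (hs : HasCompactSupport g)
    {z : ℂ} (hz : 0 < z.im) :
    poisson g z = 1 / Real.pi * (∫ y : ℝ, (g y : ℂ) / ((y : ℂ) - z)).im := by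
  have hi : Integrable (fun y : ℝ => (g y : ℂ) / ((y : ℂ) - z)) := by
    simpa using integrable_div_ofReal_sub_pow hg hs hz 1
  have h := integral_im hi
  simp only [RCLike.im_to_complex] at h
  rw [poisson, ← h]
  congr 2
  ext y
  rw [Complex.div_im]
  simp only [Complex.ofReal_im, Complex.ofReal_re, Complex.sub_re, Complex.sub_im,
    Complex.normSq_apply, zero_mul, zero_div, zero_sub]
  have : (z.re - y) ^ 2 + z.im ^ 2 ≠ 0 := by positivity
  have h' : (y - z.re) * (y - z.re) + -z.im * -z.im = (z.re - y) ^ 2 + z.im ^ 2 := by ring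
  rw [h']
  field_simp

/-- Near `z` the extension is `π⁻¹ Im G` with `G` the holomorphic Cauchy integral, and its
derivative in the direction `i` is `π⁻¹ Im (i G') = π⁻¹ Re G'`. -/
theorem hasFDerivAt_poisson {g : ℝ → ℝ} (hg : Continuous g) (hs : HasCompactSupport g)
    {z : ℂ} (hz : 0 < z.im) :
    ∃ L : ℂ →L[ℝ] ℝ, HasFDerivAt (poisson g) L z ∧
      L Complex.I = 1 / Real.pi * (cauchyDeriv g z).re := by
  have h1 := (hasDerivAt_cauchy hg hs hz).hasFDerivAt.restrictScalars ℝ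
  have h2 := (Complex.imCLM.hasFDerivAt.comp z h1).const_mul (1 / Real.pi)
  refine ⟨_, h2.congr_of_eventuallyEq ?_, ?_⟩
  · filter_upwards [(isOpen_lt continuous_const Complex.continuous_im).mem_nhds
      (show z ∈ {w : ℂ | 0 < w.im} from hz)] with w hw
    exact poisson_eq_im hg hs hw
  · simp

theorem hasDerivAt_poisson {g : ℝ → ℝ} (hg : Continuous g) (hs : HasCompactSupport g)
    (x : ℝ) {t : ℝ} (ht : 0 < t) :
    HasDerivAt (fun s : ℝ => poisson g ⟨x, s⟩) (1 / Real.pi * (cauchyDeriv g ⟨x, t⟩).re) t := by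
  obtain ⟨L, hL, hI⟩ := hasFDerivAt_poisson hg hs (z := ⟨x, t⟩) ht
  rw [← hI]
  have h : HasDerivAt (fun s : ℝ => (⟨x, s⟩ : ℂ)) Complex.I t := by
    have := ((Complex.ofRealCLM.hasDerivAt (x := t)).mul_const Complex.I).const_add (x : ℂ)
    simp only [Complex.ofRealCLM_apply, Complex.ofReal_one, one_mul] at this
    convert! this using 2
    rw [Complex.mk_eq_add_mul_I]
  exact hL.comp_hasDerivAt t h

theorem poissonDt_eq {g : ℝ → ℝ} (hg : Continuous g) (hs : HasCompactSupport g)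
    (x : ℝ) {t : ℝ} (ht : 0 < t) :
    poissonDt g t x = 1 / Real.pi * (cauchyDeriv g ⟨x, t⟩).re :=
  (hasDerivAt_poisson hg hs x ht).deriv

theorem enorm_poissonDt_le_gradient {g : ℝ → ℝ} (hg : Continuous g) (hs : HasCompactSupport g)
    {z : ℂ} (hz : 0 < z.im) :
    ‖1 / Real.pi * (cauchyDeriv g z).re‖ₑ ≤ ‖gradient (poisson g) z‖ₑ := by
  obtain ⟨L, hL, hI⟩ := hasFDerivAt_poisson hg hs hz
  rw [← hI, gradient, hL.fderiv, LinearIsometryEquiv.enorm_map, enorm_le_iff_norm_le]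
  simpa using L.le_opNorm Complex.I

theorem continuousOn_cauchyDeriv {g : ℝ → ℝ} (hg : Continuous g) (hs : HasCompactSupport g) :
    ContinuousOn (cauchyDeriv g) {z : ℂ | 0 < z.im} := by
  have ho : IsOpen {z : ℂ | 0 < z.im} := isOpen_lt continuous_const Complex.continuous_im
  have hd : DifferentiableOn ℂ (fun z : ℂ => ∫ y : ℝ, (g y : ℂ) / ((y : ℂ) - z))
      {z : ℂ | 0 < z.im} := fun z hz =>
    (hasDerivAt_cauchy hg hs hz).differentiableAt.differentiableWithinAt
  exact (hd.deriv ho).continuousOn.congr fun z hz => (hasDerivAt_cauchy hg hs hz).deriv.symm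

theorem measurable_cauchyDeriv {g : ℝ → ℝ} (hg : Continuous g) : Measurable (cauchyDeriv g) := by
  have : StronglyMeasurable (fun p : ℂ × ℝ => (g p.2 : ℂ) / ((p.2 : ℂ) - p.1) ^ 2) := by
    refine Measurable.stronglyMeasurable ?_
    have := hg.measurable
    fun_prop
  exact this.integral_prod_right'.measurable

theorem continuous_mk_im (x : ℝ) : Continuous fun t : ℝ => (⟨x, t⟩ : ℂ) := by
  have : (fun t : ℝ => (⟨x, t⟩ : ℂ)) = fun t : ℝ => (x : ℂ) + t * Complex.I := by
    ext t; rw [Complex.mk_eq_add_mul_I]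
  rw [this]
  fun_prop

theorem measurable_mk : Measurable fun p : ℝ × ℝ => (⟨p.1, p.2⟩ : ℂ) :=
  Complex.measurableEquivRealProd.symm.measurable

theorem enorm_poisson_sub_le {g : ℝ → ℝ} (hg : Continuous g) (hs : HasCompactSupport g)
    (x : ℝ) {s t : ℝ} (h0 : 0 < s) (hst : s ≤ t) :
    ‖poisson g ⟨x, t⟩ - poisson g ⟨x, s⟩‖ₑ ≤
      ∫⁻ r in Ioo s t, ‖1 / Real.pi * (cauchyDeriv g ⟨x, r⟩).re‖ₑ := by
  have hpos : ∀ r ∈ Icc s t, 0 < r := fun r hr => h0.trans_le hr.1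
  have hc : ContDiffOn ℝ 1 (fun s : ℝ => poisson g ⟨x, s⟩) (Ioi 0) := by
    rw [contDiffOn_one_iff_derivWithin (uniqueDiffOn_Ioi _)]
    refine ⟨fun r hr => (hasDerivAt_poisson hg hs x hr).differentiableAt.differentiableWithinAt, ?_⟩
    have h1 : ContinuousOn (fun r : ℝ => 1 / Real.pi * (cauchyDeriv g ⟨x, r⟩).re) (Ioi 0) := by
      have h2 : ContinuousOn (fun r : ℝ => cauchyDeriv g ⟨x, r⟩) (Ioi 0) :=
        (continuousOn_cauchyDeriv hg hs).comp (continuous_mk_im x).continuousOn fun r hr => hr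
      exact continuousOn_const.mul (Complex.continuous_re.comp_continuousOn h2)
    refine h1.congr fun r hr => ?_
    rw [derivWithin_of_isOpen isOpen_Ioi hr, (hasDerivAt_poisson hg hs x hr).deriv]
  refine (enorm_sub_le_lintegral_deriv_of_contDiffOn_Icc (hc.mono hpos) hst).trans ?_
  rw [setLIntegral_congr Ioo_ae_eq_Icc.symm]
  refine (setLIntegral_congr_fun measurableSet_Ioo fun r hr => ?_).le
  simp only [(hasDerivAt_poisson hg hs x (h0.trans hr.1)).deriv]

/-! ### Boundary values of the Poisson extension -/

/-- The substitution `y = x + t v` moves the dependence on `t` from the kernel to `g`, so that the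
maximum bound and the limit `t → 0` follow from one fixed integrable weight of mass `π`. -/
theorem poisson_eq_integral_dilation (g : ℝ → ℝ) (x : ℝ) {t : ℝ} (ht : 0 < t) :
    poisson g ⟨x, t⟩ = 1 / Real.pi * ∫ v : ℝ, (1 + v ^ 2)⁻¹ * g (x + t * v) := by
  rw [poisson]
  congr 1
  have h1 := integral_add_left_eq_self (μ := volume)
    (fun y : ℝ => t / ((x - y) ^ 2 + t ^ 2) * g y) x
  have h2 := Measure.integral_comp_mul_left
    (fun y : ℝ => t / ((x - (x + y)) ^ 2 + t ^ 2) * g (x + y)) t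
  simp only
  rw [← h1]
  rw [abs_of_pos (inv_pos.2 ht), smul_eq_mul] at h2
  have h3 := congrArg (t * ·) h2
  simp only [← mul_assoc, mul_inv_cancel₀ ht.ne', one_mul] at h3
  rw [← h3, ← integral_const_mul]
  congr 1
  ext v
  have : 1 + v ^ 2 ≠ 0 := by positivity
  have : (x - (x + t * v)) ^ 2 + t ^ 2 = t ^ 2 * (1 + v ^ 2) := by ring
  rw [this]
  field_simp

theorem integrable_inv_one_add_sq_mul {g : ℝ → ℝ} (hg : Continuous g) {B : ℝ}
    (hB : ∀ y, |g y| ≤ B) (x t : ℝ) : Integrable fun v : ℝ => (1 + v ^ 2)⁻¹ * g (x + t * v) := by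
  refine Integrable.mono' (integrable_inv_one_add_sq.mul_const B) ?_ (ae_of_all _ fun v => ?_)
  · have : ∀ v : ℝ, 1 + v ^ 2 ≠ 0 := fun v => by positivity
    exact Continuous.aestronglyMeasurable (by fun_prop (disch := exact this _))
  · rw [norm_mul, Real.norm_of_nonneg (by positivity), Real.norm_eq_abs]
    gcongr
    exact hB _

theorem abs_poisson_le {g : ℝ → ℝ} {B : ℝ} (hB : ∀ y, |g y| ≤ B)
    (x : ℝ) {t : ℝ} (ht : 0 < t) : |poisson g ⟨x, t⟩| ≤ B := by
  rw [poisson_eq_integral_dilation g x ht, abs_mul, abs_of_pos (by positivity)]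
  have : |∫ v : ℝ, (1 + v ^ 2)⁻¹ * g (x + t * v)| ≤ ∫ v : ℝ, (1 + v ^ 2)⁻¹ * B := by
    rw [← Real.norm_eq_abs]
    refine norm_integral_le_of_norm_le (integrable_inv_one_add_sq.mul_const B)
      (ae_of_all _ fun v => ?_)
    rw [norm_mul, Real.norm_of_nonneg (by positivity), Real.norm_eq_abs]
    gcongr
    exact hB _
  rw [integral_mul_const, integral_univ_inv_one_add_sq] at this
  calc _ ≤ 1 / Real.pi * (Real.pi * B) := by gcongr
    _ = B := by field_simp

theorem tendsto_poisson_zero {g : ℝ → ℝ} (hg : Continuous g) {B : ℝ} (hB : ∀ y, |g y| ≤ B)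
    (x : ℝ) : Tendsto (fun t : ℝ => poisson g ⟨x, t⟩) (𝓝[>] 0) (𝓝 (g x)) := by
  have h : Tendsto (fun t : ℝ => 1 / Real.pi * ∫ v : ℝ, (1 + v ^ 2)⁻¹ * g (x + t * v)) (𝓝[>] 0)
      (𝓝 (1 / Real.pi * ∫ v : ℝ, (1 + v ^ 2)⁻¹ * g x)) := by
    refine Tendsto.const_mul _ (tendsto_integral_filter_of_dominated_convergence
      (fun v => (1 + v ^ 2)⁻¹ * B) ?_ ?_ (integrable_inv_one_add_sq.mul_const B) ?_)
    · exact Eventually.of_forall fun t =>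
        (integrable_inv_one_add_sq_mul hg hB x t).aestronglyMeasurable
    · refine Eventually.of_forall fun t => ae_of_all _ fun v => ?_
      rw [norm_mul, Real.norm_of_nonneg (by positivity), Real.norm_eq_abs]
      gcongr
      exact hB _
    · refine ae_of_all _ fun v => Tendsto.const_mul _ ?_
      have : Continuous fun t : ℝ => g (x + t * v) := by fun_prop
      simpa using (this.tendsto 0).mono_left nhdsWithin_le_nhds
  rw [integral_mul_const, integral_univ_inv_one_add_sq, ← mul_assoc,
    one_div_mul_cancel Real.pi_ne_zero, one_mul] at h
  refine h.congr' ?_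
  filter_upwards [self_mem_nhdsWithin] with t ht
  exact (poisson_eq_integral_dilation g x ht).symm

theorem enorm_sub_poisson_le {g : ℝ → ℝ} (hg : Continuous g) (hs : HasCompactSupport g)
    {B : ℝ} (hB : ∀ y, |g y| ≤ B) (x : ℝ) {t : ℝ} (ht : 0 < t) :
    ‖poisson g ⟨x, t⟩ - g x‖ₑ ≤
      ∫⁻ r in Ioo 0 t, ‖1 / Real.pi * (cauchyDeriv g ⟨x, r⟩).re‖ₑ := by
  have h := ((tendsto_poisson_zero hg hB x).const_sub (poisson g ⟨x, t⟩)).enorm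
  refine le_of_tendsto h ?_
  filter_upwards [Ioo_mem_nhdsGT ht] with s hs'
  exact (enorm_poisson_sub_le hg hs x hs'.1 hs'.2.le).trans
    (lintegral_mono_set (Ioo_subset_Ioo_left hs'.1.le))

/-! ### Variation over strips -/

/-- The variation `∫_s^t ∫_0^1 |∂_r u(r, x)| dx dr` of the Poisson extension of `g`. -/
def poissonVariation (g : ℝ → ℝ) (s t : ℝ) : ℝ≥0∞ :=
  ∫⁻ r in Ioo s t, ∫⁻ x in Ioo (0 : ℝ) 1, ‖1 / Real.pi * (cauchyDeriv g ⟨x, r⟩).re‖ₑ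

theorem measurable_enorm_re_cauchyDeriv {g : ℝ → ℝ} (hg : Continuous g) :
    Measurable fun z : ℂ => ‖1 / Real.pi * (cauchyDeriv g z).re‖ₑ := by
  have := measurable_cauchyDeriv hg
  fun_prop

theorem measurable_enorm_re_cauchyDeriv_prod {g : ℝ → ℝ} (hg : Continuous g) :
    Measurable fun p : ℝ × ℝ => ‖1 / Real.pi * (cauchyDeriv g ⟨p.2, p.1⟩).re‖ₑ :=
  (measurable_enorm_re_cauchyDeriv hg).comp (measurable_mk.comp measurable_swap)

theorem lintegral_enorm_sub_poisson_le {g : ℝ → ℝ} (hg : Continuous g) (hs : HasCompactSupport g)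
    {B : ℝ} (hB : ∀ y, |g y| ≤ B) {t : ℝ} (ht : 0 < t) :
    ∫⁻ x in Ioo (0 : ℝ) 1, ‖poisson g ⟨x, t⟩ - g x‖ₑ ≤ poissonVariation g 0 t := by
  rw [poissonVariation, lintegral_lintegral_swap
    (measurable_enorm_re_cauchyDeriv_prod hg).aemeasurable]
  exact lintegral_mono fun x => enorm_sub_poisson_le hg hs hB x ht

/-! ### Cosines of high frequency and their strips -/

/-- A smooth cutoff, equal to `1` on `[-1, 1]` and supported in `[-2, 2]`. -/
def cutoff : ContDiffBump (0 : ℝ) := ⟨1, 2, one_pos, one_lt_two⟩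

/-- A cosine of frequency `n`, cut off to `[-2, 2]`. -/
def cutoffCos (n : ℕ) (x : ℝ) : ℝ := cutoff x * Real.cos (2 * Real.pi * n * x)

theorem contDiff_cutoffCos (n : ℕ) : ContDiff ℝ ∞ (cutoffCos n) := by
  unfold cutoffCos
  exact cutoff.contDiff.mul (Real.contDiff_cos.comp (by fun_prop))

theorem abs_cutoffCos_le (n : ℕ) (x : ℝ) : |cutoffCos n x| ≤ 1 := by
  rw [cutoffCos, abs_mul, abs_of_nonneg cutoff.nonneg]
  exact mul_le_one₀ cutoff.le_one (abs_nonneg _) (Real.abs_cos_le_one _)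

theorem cutoffCos_eq_zero (n : ℕ) {x : ℝ} (hx : x ∉ Icc (-2 : ℝ) 2) : cutoffCos n x = 0 := by
  rw [cutoffCos, cutoff.zero_of_le_dist, zero_mul]
  rw [Real.dist_eq, sub_zero]
  by_contra! h
  exact hx ⟨(abs_lt.1 h).1.le, (abs_lt.1 h).2.le⟩

theorem hasCompactSupport_of_eq_zero {g : ℝ → ℝ} (hg : ∀ x ∉ Icc (-2 : ℝ) 2, g x = 0) :
    HasCompactSupport g :=
  HasCompactSupport.intro isCompact_Icc hg

/-- On `(0, 1)` the cutoff is `1` and `|cos| ≥ cos²`, which has mean `1/2` over whole periods. -/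
theorem half_le_lintegral_cutoffCos {n : ℕ} (hn : n ≠ 0) :
    ENNReal.ofReal (1 / 2) ≤ ∫⁻ x in Ioo (0 : ℝ) 1, ‖cutoffCos n x‖ₑ := by
  have h1 : ∫ x in (0 : ℝ)..1, Real.cos (2 * Real.pi * n * x) ^ 2 = 1 / 2 := by
    have hc : 2 * Real.pi * (n : ℝ) ≠ 0 := by positivity
    rw [intervalIntegral.integral_comp_mul_left (fun x => Real.cos x ^ 2) hc, integral_cos_sq]
    have hs : Real.sin (2 * Real.pi * n * 1) = 0 := by
      have := Real.sin_nat_mul_pi (2 * n)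
      push_cast at this
      rw [← this]
      ring_nf
    rw [hs]
    simp
    field_simp
  rw [intervalIntegral.integral_of_le zero_le_one, integral_Ioc_eq_integral_Ioo] at h1
  rw [← h1, ofReal_integral_eq_lintegral_ofReal]
  · refine setLIntegral_mono' measurableSet_Ioo fun x hx => ?_
    rw [Real.enorm_eq_ofReal_abs]
    refine ENNReal.ofReal_le_ofReal ?_
    have h1 : cutoff x = 1 := cutoff.one_of_mem_closedBall (by
      simp only [Metric.mem_closedBall, Real.dist_eq, sub_zero, cutoff]
      rw [abs_of_pos hx.1]; exact hx.2.le)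
    rw [cutoffCos, h1, one_mul, ← sq_abs]
    have := Real.abs_cos_le_one (2 * Real.pi * n * x)
    have := abs_nonneg (Real.cos (2 * Real.pi * n * x))
    nlinarith
  · exact (Continuous.integrableOn_Icc (by fun_prop)).mono_set Ioo_subset_Icc_self
  · exact ae_of_all _ fun x => sq_nonneg _

/-- Riemann–Lebesgue: the value is `π⁻¹` times the real part of the Fourier integral, at frequency
`n`, of the Poisson kernel times the cutoff. -/
theorem tendsto_poisson_cutoffCos (x : ℝ) (t : ℝ) :
    Tendsto (fun n : ℕ => poisson (cutoffCos n) ⟨x, t⟩) atTop (𝓝 0) := by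
  rcases eq_or_ne t 0 with rfl | ht
  · simp [poisson]
  let F : ℝ → ℂ := fun y => ((t / ((x - y) ^ 2 + t ^ 2) * cutoff y : ℝ) : ℂ)
  have hF : Integrable F := by
    apply Continuous.integrable_of_hasCompactSupport
    · have h : ∀ y : ℝ, (x - y) ^ 2 + t ^ 2 ≠ 0 := fun y => by positivity
      have h' := cutoff.continuous
      exact Complex.continuous_ofReal.comp (by fun_prop (disch := exact h _))
    · refine cutoff.hasCompactSupport.mono fun y hy => ?_
      simp only [Function.mem_support] at hy ⊢
      rintro h
      simp [F, h] at hy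
  have h1 : Tendsto (fun n : ℕ => (n : ℝ)) atTop (cocompact ℝ) :=
    tendsto_natCast_atTop_atTop.mono_right atTop_le_cocompact
  have h2 := (Real.tendsto_integral_exp_smul_cocompact F).comp h1
  have h3 := ((Complex.continuous_re.tendsto _).comp h2).const_mul (1 / Real.pi)
  simp only [Complex.zero_re, mul_zero] at h3
  refine h3.congr fun n => ?_
  have hint : Integrable (fun v : ℝ => Real.fourierChar (-(v * (n : ℝ))) • F v) := by
    have := (Real.fourierIntegral_convergent_iff (n : ℝ)).2 hF
    simpa [mul_comm] using this
  have h4 := integral_re hint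
  simp only [RCLike.re_to_complex] at h4
  simp only [Function.comp_apply, poisson]
  rw [← h4]
  congr 2
  ext y
  rw [Circle.smul_def, Real.fourierChar_apply, smul_eq_mul]
  simp only [F]
  rw [Complex.re_mul_ofReal]
  rw [Complex.exp_ofReal_mul_I_re, cutoffCos,
    show 2 * Real.pi * -(y * (n : ℝ)) = -(2 * Real.pi * n * y) by ring, Real.cos_neg]
  ring

theorem measurable_poisson {g : ℝ → ℝ} (hg : Continuous g) : Measurable (poisson g) := by
  have : StronglyMeasurable
      (fun p : ℂ × ℝ => p.1.im / ((p.1.re - p.2) ^ 2 + p.1.im ^ 2) * g p.2) := by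
    refine Measurable.stronglyMeasurable ?_
    have := hg.measurable
    fun_prop
  exact (this.integral_prod_right'.measurable).const_mul _

theorem tendsto_lintegral_poisson_cutoffCos {t : ℝ} (ht : 0 < t) :
    Tendsto (fun n : ℕ => ∫⁻ x in Ioo (0 : ℝ) 1, ‖poisson (cutoffCos n) ⟨x, t⟩‖ₑ) atTop (𝓝 0) := by
  have h := tendsto_lintegral_of_dominated_convergence
    (μ := volume.restrict (Ioo (0 : ℝ) 1))
    (F := fun (n : ℕ) (x : ℝ) => ‖poisson (cutoffCos n) ⟨x, t⟩‖ₑ) (f := fun _ => 0)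
    (fun _ => 1) ?_ ?_ ?_ ?_
  · simpa using h
  · intro n
    exact ((measurable_poisson (contDiff_cutoffCos n).continuous).comp
      (measurable_mk.comp measurable_prodMk_right)).enorm
  · intro n
    refine ae_of_all _ fun x => ?_
    beta_reduce
    rw [Real.enorm_eq_ofReal_abs, ← ENNReal.ofReal_one]
    exact ENNReal.ofReal_le_ofReal (abs_poisson_le (abs_cutoffCos_le n) x ht)
  · simp
  · refine ae_of_all _ fun x => ?_
    simpa using (tendsto_poisson_cutoffCos x t).enorm

/-- The `L₁(0,1)` norm is at least `1/2` on the boundary and at most `1/4` at height `t` once `n` is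
large; the variation below `t` pays for the difference. -/
theorem exists_quarter_le_poissonVariation {t : ℝ} (ht : 0 < t) :
    ∃ n : ℕ, ENNReal.ofReal (1 / 4) ≤ poissonVariation (cutoffCos n) 0 t := by
  have h := (tendsto_lintegral_poisson_cutoffCos ht).eventually_lt_const
    (show (0 : ℝ≥0∞) < ENNReal.ofReal (1 / 4) by simp)
  obtain ⟨n, hn, hn0⟩ := (h.and (eventually_ne_atTop 0)).exists
  refine ⟨n, ?_⟩
  have hc := (contDiff_cutoffCos n).continuous
  have hsupp := hasCompactSupport_of_eq_zero fun x hx => cutoffCos_eq_zero n hx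
  have h1 : ENNReal.ofReal (1 / 2) ≤
      poissonVariation (cutoffCos n) 0 t + ENNReal.ofReal (1 / 4) := by
    refine (half_le_lintegral_cutoffCos hn0).trans (le_trans ?_ (add_le_add
      (lintegral_enorm_sub_poisson_le hc hsupp (abs_cutoffCos_le n) ht) hn.le))
    have hm : Measurable fun x : ℝ => ‖poisson (cutoffCos n) ⟨x, t⟩‖ₑ :=
      ((measurable_poisson hc).comp (measurable_mk.comp measurable_prodMk_right)).enorm
    rw [← lintegral_add_right _ hm]
    refine lintegral_mono fun x => ?_
    rw [← enorm_neg (poisson _ _ - _), neg_sub]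
    simpa using enorm_add_le (cutoffCos n x - poisson (cutoffCos n) ⟨x, t⟩)
      (poisson (cutoffCos n) ⟨x, t⟩)
  have h2 : ENNReal.ofReal (1 / 2) = ENNReal.ofReal (1 / 4) + ENNReal.ofReal (1 / 4) := by
    rw [← ENNReal.ofReal_add (by norm_num) (by norm_num)]; norm_num
  rw [h2] at h1
  exact (ENNReal.add_le_add_iff_right ENNReal.ofReal_ne_top).1 h1

theorem exists_eighth_le_poissonVariation {t : ℝ} (ht : 0 < t) :
    ∃ (n : ℕ) (s : ℝ), 0 < s ∧ s < t ∧
      ENNReal.ofReal (1 / 8) ≤ poissonVariation (cutoffCos n) s t := by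
  obtain ⟨n, hn⟩ := exists_quarter_le_poissonVariation ht
  by_contra! hcon
  -- Monotone convergence over these strips moves the lower end off the boundary; the shift by `2`
  -- keeps it strictly below `t` for `k = 0`.
  have hU : Ioo 0 t = ⋃ k : ℕ, Ioo (t / (k + 2)) t := by
    ext r
    simp only [mem_Ioo, mem_iUnion, exists_and_right]
    refine and_congr_left fun hr => ⟨fun h => ?_, fun ⟨k, hk⟩ => lt_trans (by positivity) hk⟩
    obtain ⟨k, hk⟩ := exists_nat_gt (t / r)
    refine ⟨k, ?_⟩
    rw [div_lt_iff₀ (by positivity)]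
    rw [div_lt_iff₀ h] at hk
    nlinarith
  rw [poissonVariation, hU, setLIntegral_iUnion_of_directed] at hn
  · have : ENNReal.ofReal (1 / 4) ≤ ENNReal.ofReal (1 / 8) := by
      refine hn.trans (iSup_le fun k => ?_)
      have h2 : t / ((k : ℝ) + 2) < t := by
        rw [div_lt_iff₀ (by positivity)]
        nlinarith [(Nat.cast_nonneg k : (0 : ℝ) ≤ k)]
      exact (hcon n (t / (k + 2)) (by positivity) h2).le
    rw [ENNReal.ofReal_le_ofReal_iff (by norm_num)] at this
    norm_num at this
  · refine directed_of_isDirected_le fun i j hij => Ioo_subset_Ioo_left ?_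
    have : (i : ℝ) ≤ j := by exact_mod_cast hij
    gcongr

theorem exists_frequencies_and_heights : ∃ (n : ℕ → ℕ) (T : ℕ → ℝ), T 0 = 1 ∧ (∀ k, 0 < T k) ∧
    (∀ k, T (k + 1) < T k) ∧
    ∀ k, ENNReal.ofReal (1 / 8) ≤ poissonVariation (cutoffCos (n k)) (T (k + 1)) (T k) := by
  choose! N S hS0 hSt hN using fun (t : ℝ) (ht : 0 < t) => exists_eighth_le_poissonVariation ht
  let T : ℕ → ℝ := fun k => S^[k] 1
  have hT : ∀ k, T (k + 1) = S (T k) := fun k => Function.iterate_succ_apply' S k 1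
  have hpos : ∀ k, 0 < T k := by
    intro k
    induction k with
    | zero => exact one_pos
    | succ k ih => rw [hT]; exact hS0 _ ih
  refine ⟨fun k => N (T k), T, rfl, hpos, fun k => ?_, fun k => ?_⟩
  · rw [hT]; exact hSt _ (hpos k)
  · rw [hT]; exact hN _ (hpos k)

/-! ### Products with random signs -/

/-- The sign attached to a Boolean. -/
def boolSign (b : Bool) : ℝ := if b then 1 else -1

theorem abs_boolSign (b : Bool) : |boolSign b| = 1 := by cases b <;> simp [boolSign]

/-- The sum over all signs factorises over `k`. The two signs contribute `2` in a factor `k ≠ j` and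
`2 i a_j` in the factor `j`. -/
theorem sum_boolSign_mul_prod {N : ℕ} (a : Fin N → ℝ) (j : Fin N) :
    ∑ e : Fin N → Bool, boolSign (e j) * (∏ k, (1 + (boolSign (e k) * a k : ℝ) * Complex.I)).im =
      2 ^ N * a j := by
  have h1 : ∑ e : Fin N → Bool,
      ∏ k, ((if k = j then (boolSign (e k) : ℂ) else 1) *
        (1 + (boolSign (e k) * a k : ℝ) * Complex.I)) = 2 ^ N * (a j * Complex.I) := by
    rw [← Fintype.prod_sum (fun (k : Fin N) (b : Bool) =>
      ((if k = j then (boolSign b : ℂ) else 1) * (1 + (boolSign b * a k : ℝ) * Complex.I)))]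
    have : ∀ k, ∑ b : Bool, ((if k = j then (boolSign b : ℂ) else 1) *
        (1 + (boolSign b * a k : ℝ) * Complex.I)) =
        2 * (if k = j then (a j * Complex.I) else 1) := by
      intro k
      rw [Fintype.sum_bool]
      split_ifs with h
      · subst h; simp [boolSign]; ring
      · simp [boolSign]; ring
    simp_rw [this]
    rw [Finset.prod_mul_distrib, Finset.prod_const, Finset.card_univ, Fintype.card_fin,
      Finset.prod_ite_eq' Finset.univ j fun _ => (a j * Complex.I)]
    simp
  have h2 := congrArg Complex.im h1
  rw [Complex.im_sum] at h2
  have h3 : ((2 : ℂ) ^ N * (a j * Complex.I)).im = 2 ^ N * a j := by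
    rw [← mul_assoc, Complex.mul_I_im]
    have : (2 : ℂ) ^ N * a j = ((2 ^ N * a j : ℝ) : ℂ) := by push_cast; ring
    rw [this, Complex.ofReal_re]
  rw [h3] at h2
  rw [← h2]
  refine Finset.sum_congr rfl fun e _ => ?_
  rw [Finset.prod_mul_distrib, Finset.prod_ite_eq' Finset.univ j fun k => (boolSign (e k) : ℂ)]
  simp

/-- The imaginary part of a product of factors `1 ± i c_k`, which stays bounded while every `c_k`
can be recovered from it by averaging over the signs. -/
def signedProduct {N : ℕ} (c : Fin N → ℝ → ℝ) (e : Fin N → Bool) (x : ℝ) : ℝ :=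
  (∏ k, (1 + (boolSign (e k) * c k x : ℝ) * Complex.I)).im

theorem contDiff_signedProduct {N : ℕ} {c : Fin N → ℝ → ℝ} (hc : ∀ k, ContDiff ℝ ∞ (c k))
    (e : Fin N → Bool) : ContDiff ℝ ∞ (signedProduct c e) := by
  refine Complex.imCLM.contDiff.comp (contDiff_prod fun k _ => ?_)
  refine contDiff_const.add (ContDiff.mul ?_ contDiff_const)
  exact Complex.ofRealCLM.contDiff.comp (contDiff_const.mul (hc k))

theorem signedProduct_eq_zero {N : ℕ} {c : Fin N → ℝ → ℝ} (e : Fin N → Bool) {x : ℝ}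
    (hx : ∀ k, c k x = 0) : signedProduct c e x = 0 := by
  simp [signedProduct, hx]

/-- The squared modulus of the product is `∏ (1 + c_k²) ≤ (1 + 1/N)^N ≤ e < 4`. -/
theorem abs_signedProduct_le {N : ℕ} {c : Fin N → ℝ → ℝ} (e : Fin N → Bool) {x : ℝ}
    (hx : ∀ k, |c k x| ≤ 1 / √N) : |signedProduct c e x| ≤ 2 := by
  refine (Complex.abs_im_le_norm _).trans ?_
  refine abs_le_of_sq_le_sq' ?_ zero_le_two |>.2
  rw [norm_prod, ← Finset.prod_pow]
  have hb : ∀ k ∈ Finset.univ, ‖1 + (boolSign (e k) * c k x : ℝ) * Complex.I‖ ^ 2 ≤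
      Real.exp (1 / N) := by
    intro k _
    rw [← Complex.normSq_eq_norm_sq, ← Complex.ofReal_one, Complex.normSq_add_mul_I]
    have h1 : (boolSign (e k) * c k x) ^ 2 ≤ 1 / (N : ℝ) := by
      rw [← sq_abs, abs_mul, abs_boolSign, one_mul]
      calc |c k x| ^ 2 ≤ (1 / √(N : ℝ)) ^ 2 := by gcongr; exact hx k
        _ = 1 / (N : ℝ) := by rw [div_pow, Real.sq_sqrt (Nat.cast_nonneg N), one_pow]
    have := Real.add_one_le_exp (1 / (N : ℝ))
    linarith
  refine (Finset.prod_le_prod (fun k _ => by positivity) hb).trans ?_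
  rw [Finset.prod_const, Finset.card_univ, Fintype.card_fin, ← Real.exp_nat_mul]
  have : (N : ℝ) * (1 / N) ≤ 1 := by
    rcases eq_or_ne N 0 with rfl | h
    · simp
    · field_simp; rfl
  have h2 := Real.exp_le_exp.2 this
  have := Real.exp_one_lt_d9
  linarith

theorem cauchyDeriv_eq_sum {N : ℕ} {c : Fin N → ℝ → ℝ} (hc : ∀ k, ContDiff ℝ ∞ (c k))
    (hs : ∀ k, ∀ x ∉ Icc (-2 : ℝ) 2, c k x = 0) (j : Fin N) {z : ℂ} (hz : 0 < z.im) :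
    2 ^ N * cauchyDeriv (c j) z =
      ∑ e : Fin N → Bool, boolSign (e j) * cauchyDeriv (signedProduct c e) z := by
  simp only [cauchyDeriv, ← integral_const_mul]
  rw [← integral_finsetSum]
  · congr 1
    ext y
    have h := congrArg Complex.ofReal (sum_boolSign_mul_prod (fun k => c k y) j)
    push_cast at h
    rw [← mul_div_assoc, ← h, Finset.sum_div]
    refine Finset.sum_congr rfl fun e _ => ?_
    simp only [signedProduct]
    push_cast
    ring
  · intro e _
    refine (integrable_div_ofReal_sub_pow (contDiff_signedProduct hc e).continuous
      (hasCompactSupport_of_eq_zero fun x hx => ?_) hz 2).const_mul _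
    exact signedProduct_eq_zero e fun k => hs k x hx

theorem enorm_re_cauchyDeriv_le_sum {N : ℕ} {c : Fin N → ℝ → ℝ} (hc : ∀ k, ContDiff ℝ ∞ (c k))
    (hs : ∀ k, ∀ x ∉ Icc (-2 : ℝ) 2, c k x = 0) (j : Fin N) {z : ℂ} (hz : 0 < z.im) :
    2 ^ N * ‖1 / Real.pi * (cauchyDeriv (c j) z).re‖ₑ ≤
      ∑ e : Fin N → Bool, ‖1 / Real.pi * (cauchyDeriv (signedProduct c e) z).re‖ₑ := by
  have h := congrArg Complex.re (cauchyDeriv_eq_sum hc hs j hz)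
  rw [Complex.re_sum] at h
  have h2 : ((2 : ℂ) ^ N * cauchyDeriv (c j) z).re = 2 ^ N * (cauchyDeriv (c j) z).re := by
    rw [show (2 : ℂ) ^ N = ((2 ^ N : ℝ) : ℂ) by push_cast; ring, Complex.re_ofReal_mul]
  rw [h2] at h
  have h3 : (2 : ℝ≥0∞) ^ N = ‖(2 : ℝ) ^ N‖ₑ := by
    rw [Real.enorm_eq_ofReal (by positivity), ENNReal.ofReal_pow zero_le_two]
    simp
  rw [h3, ← enorm_mul, mul_left_comm, h, Finset.mul_sum]
  refine (enorm_sum_le _ _).trans (Finset.sum_le_sum fun e _ => ?_)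
  rw [Complex.re_ofReal_mul, mul_left_comm, enorm_mul, Real.enorm_eq_ofReal_abs, abs_boolSign]
  simp

theorem mul_lintegral_lintegral_le_sum {ι : Type*} [Fintype ι] {K : ℝ≥0∞} (hK : K ≠ ⊤)
    {A B : Set ℝ} (hA : MeasurableSet A) {G : ℝ → ℝ → ℝ≥0∞} {F : ι → ℝ → ℝ → ℝ≥0∞}
    (hF : ∀ e, Measurable fun p : ℝ × ℝ => F e p.1 p.2)
    (h : ∀ r ∈ A, ∀ x, K * G r x ≤ ∑ e, F e r x) :
    K * ∫⁻ r in A, ∫⁻ x in B, G r x ≤ ∑ e, ∫⁻ r in A, ∫⁻ x in B, F e r x := by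
  have hm1 : ∀ e, Measurable fun r : ℝ => ∫⁻ x in B, F e r x :=
    fun e => (hF e).lintegral_prod_right'
  have hm2 : ∀ r e, Measurable fun x : ℝ => F e r x :=
    fun r e => (hF e).comp measurable_prodMk_left
  rw [← lintegral_finsetSum _ fun e _ => hm1 e, ← lintegral_const_mul' _ _ hK]
  refine setLIntegral_mono' hA fun r hr => ?_
  rw [← lintegral_finsetSum _ fun e _ => hm2 r e, ← lintegral_const_mul' _ _ hK]
  exact lintegral_mono fun x => h r hr x

theorem poissonVariation_le_sum {N : ℕ} {c : Fin N → ℝ → ℝ} (hc : ∀ k, ContDiff ℝ ∞ (c k))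
    (hs : ∀ k, ∀ x ∉ Icc (-2 : ℝ) 2, c k x = 0) (j : Fin N) {s t : ℝ} (h0 : 0 < s) :
    2 ^ N * poissonVariation (c j) s t ≤
      ∑ e : Fin N → Bool, poissonVariation (signedProduct c e) s t :=
  mul_lintegral_lintegral_le_sum (ENNReal.pow_ne_top ENNReal.ofNat_ne_top) measurableSet_Ioo
    (fun e => measurable_enorm_re_cauchyDeriv_prod (contDiff_signedProduct hc e).continuous)
    fun r hr x => enorm_re_cauchyDeriv_le_sum hc hs j (z := ⟨x, r⟩) (h0.trans hr.1)

theorem poissonVariation_add_le (g : ℝ → ℝ) {r s t : ℝ} (hrs : r ≤ s) (hst : s ≤ t) :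
    poissonVariation g r s + poissonVariation g s t ≤ poissonVariation g r t := by
  unfold poissonVariation
  rw [← lintegral_union measurableSet_Ioo]
  · exact lintegral_mono_set (union_subset (Ioo_subset_Ioo_right hst) (Ioo_subset_Ioo_left hrs))
  · rw [Set.disjoint_left]
    exact fun a h1 h2 => lt_asymm h1.2 h2.1

theorem sum_poissonVariation_le (g : ℝ → ℝ) {T : ℕ → ℝ} (hT : ∀ k, T (k + 1) < T k) (N : ℕ) :
    ∑ k ∈ Finset.range N, poissonVariation g (T (k + 1)) (T k) ≤
      poissonVariation g (T N) (T 0) := by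
  induction N with
  | zero => simp
  | succ N ih =>
    rw [Finset.sum_range_succ, add_comm]
    refine (add_le_add_right ih _).trans (poissonVariation_add_le g (hT N).le ?_)
    exact (strictAnti_nat_of_succ_lt hT).antitone (Nat.zero_le N)

theorem poissonVariation_const_mul (a : ℝ) (g : ℝ → ℝ) (s t : ℝ) :
    poissonVariation (fun x => a * g x) s t = ‖a‖ₑ * poissonVariation g s t := by
  have h : ∀ z, cauchyDeriv (fun x => a * g x) z = a * cauchyDeriv g z := fun z => by
    simp only [cauchyDeriv, ← integral_const_mul]
    congr 1; ext y; push_cast; ring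
  simp only [poissonVariation]
  rw [← lintegral_const_mul' _ _ enorm_ne_top]
  congr 1; ext r
  rw [← lintegral_const_mul' _ _ enorm_ne_top]
  congr 1; ext x
  rw [h, Complex.re_ofReal_mul, mul_left_comm, enorm_mul]

/-- There are uniformly bounded functions with support in a fixed interval whose Poisson extensions
have arbitrarily large variation over the unit square. -/
theorem exists_large_poissonVariation (M : ℝ≥0) : ∃ g : ℝ → ℝ, ContDiff ℝ ∞ g ∧
    (∀ x ∉ Icc (-2 : ℝ) 2, g x = 0) ∧ (∀ x, |g x| ≤ 2) ∧ M ≤ poissonVariation g 0 1 := by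
  obtain ⟨n, T, hT0, hTpos, hT, hV⟩ := exists_frequencies_and_heights
  -- With `N = m²` the averaged variation is at least `√N / 8 = m / 8`, which exceeds `M`.
  obtain ⟨m, hm⟩ := exists_nat_gt (8 * (M : ℝ))
  let N := m ^ 2
  have hmpos : 0 < m := by
    have : (0 : ℝ) < m := lt_of_le_of_lt (by positivity) hm
    exact_mod_cast this
  have hmR : (0 : ℝ) < m := by exact_mod_cast hmpos
  have hsqrt : √(N : ℝ) = m := by simp [N]
  let c : Fin N → ℝ → ℝ := fun k x => 1 / √N * cutoffCos (n k) x
  have hc : ∀ k, ContDiff ℝ ∞ (c k) := fun k => contDiff_const.mul (contDiff_cutoffCos _)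
  have hs : ∀ k, ∀ x ∉ Icc (-2 : ℝ) 2, c k x = 0 := fun k x hx => by
    simp [c, cutoffCos_eq_zero _ hx]
  have hb : ∀ k x, |c k x| ≤ 1 / √N := fun k x => by
    rw [abs_mul, abs_of_nonneg (by positivity)]
    exact mul_le_of_le_one_right (by positivity) (abs_cutoffCos_le _ _)
  have hex : ∃ e : Fin N → Bool, (M : ℝ≥0∞) ≤ poissonVariation (signedProduct c e) 0 1 := by
    -- Summing over all strips and signs gives at least `2^N · N · (1/m) · (1/8)`. If every choice
    -- of signs stayed below `M`, the total would be at most `2^N · M`.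
    by_contra! hcon
    have h1 : ∀ k : Fin N, 2 ^ N * (ENNReal.ofReal (1 / m) * ENNReal.ofReal (1 / 8)) ≤
        ∑ e : Fin N → Bool, poissonVariation (signedProduct c e) (T (k + 1)) (T k) := by
      intro k
      refine le_trans ?_ (poissonVariation_le_sum hc hs k (hTpos _))
      gcongr
      rw [poissonVariation_const_mul, hsqrt, Real.enorm_eq_ofReal (by positivity)]
      gcongr
      exact hV k
    have h2 := Finset.sum_le_sum fun k (_ : k ∈ Finset.univ) => h1 k
    rw [Finset.sum_comm, Finset.sum_const, Finset.card_univ, Fintype.card_fin] at h2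
    have h3 : ∀ e : Fin N → Bool,
        ∑ k : Fin N, poissonVariation (signedProduct c e) (T (k + 1)) (T k) ≤ M := by
      intro e
      rw [Fin.sum_univ_eq_sum_range
        (fun k => poissonVariation (signedProduct c e) (T (k + 1)) (T k)) N]
      refine (sum_poissonVariation_le _ hT N).trans (le_trans ?_ (hcon e).le)
      rw [hT0]
      exact lintegral_mono_set (Ioo_subset_Ioo_left (hTpos N).le)
    have h4 := h2.trans (Finset.sum_le_sum fun e _ => h3 e)
    rw [Finset.sum_const, Finset.card_univ, Fintype.card_fun, Fintype.card_bool, Fintype.card_fin,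
      nsmul_eq_mul, nsmul_eq_mul] at h4
    push_cast at h4
    rw [mul_left_comm] at h4
    rw [ENNReal.mul_le_mul_iff_right (by simp) (by simp)] at h4
    have h5 : ((N : ℕ) : ℝ≥0∞) = ENNReal.ofReal (m ^ 2) := by
      rw [← ENNReal.ofReal_natCast]; simp [N]
    rw [h5, ← ENNReal.ofReal_mul (by positivity), ← ENNReal.ofReal_mul (by positivity),
      ← ENNReal.ofReal_coe_nnreal, ENNReal.ofReal_le_ofReal_iff (by positivity)] at h4
    have : (m : ℝ) ^ 2 * (1 / m * (1 / 8)) = m / 8 := by field_simp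
    linarith
  obtain ⟨e, he⟩ := hex
  exact ⟨signedProduct c e, contDiff_signedProduct hc e,
    fun x hx => signedProduct_eq_zero e fun k => hs k x hx,
    fun x => abs_signedProduct_le e fun k => hb k x, he⟩

/-! ### The Beurling transform of a test function -/

theorem IsTest.eq_zero {f : ℂ → ℂ} (hf : IsTest f) {w : ℂ} (hw : w ∉ halfPlane) : f w = 0 :=
  image_eq_zero_of_notMem_tsupport fun h => hw (hf.2.2 h)

theorem measurableSet_lt_norm (ε : ℝ) : MeasurableSet {v : ℂ | ε < ‖v‖} :=
  measurableSet_lt measurable_const measurable_norm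

theorem beurlingTrunc_eq_integral_indicator {f : ℂ → ℂ} (hf : IsTest f) (ε : ℝ) (z : ℂ) :
    beurlingTrunc f ε z = -1 / (Real.pi : ℂ) *
      ∫ v : ℂ, {v : ℂ | ε < ‖v‖}.indicator (fun v => f (z + v) / v ^ 2) v := by
  have hm : MeasurableSet {w : ℂ | ε < ‖w - z‖} :=
    measurableSet_lt measurable_const (by fun_prop)
  rw [beurlingTrunc, ← setIntegral_eq_of_subset_of_forall_sdiff_eq_zero hm fun w hw => hw.2,
    ← integral_indicator hm, ← integral_add_left_eq_self _ z]
  · congr 2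
    ext v
    simp [indicator]
  · rintro w ⟨h1, h2⟩
    rw [hf.eq_zero fun h => h2 ⟨h, h1⟩, zero_div]

theorem integrable_indicator_lt_norm_div_sq {f : ℂ → ℂ} (hf : Continuous f)
    (hs : HasCompactSupport f) {ε : ℝ} (hε : 0 < ε) (z : ℂ) :
    Integrable ({v : ℂ | ε < ‖v‖}.indicator fun v => f (z + v) / v ^ 2) := by
  have hi : Integrable fun v => f (z + v) := (hf.integrable_of_hasCompactSupport hs).comp_add_left z
  refine Integrable.mono' (hi.norm.div_const (ε ^ 2)) ?_ (ae_of_all _ fun v => ?_)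
  · refine (Measurable.indicator ?_ (measurableSet_lt_norm ε)).aestronglyMeasurable
    have := hf.measurable
    fun_prop
  · simp only [indicator, mem_ofPred_eq]
    split_ifs with h
    · rw [norm_div, norm_pow]
      gcongr
    · rw [norm_zero]; positivity

/-- Rotation by `i` preserves area and the truncation but changes the sign of `v²`. Averaging with
the rotated integral replaces `f` by a difference and removes the singularity. -/
theorem two_mul_integral_indicator_lt_norm {f : ℂ → ℂ} (hf : Continuous f)
    (hs : HasCompactSupport f) {ε : ℝ} (hε : 0 < ε) (z : ℂ) :
    2 * ∫ v : ℂ, {v : ℂ | ε < ‖v‖}.indicator (fun v => f (z + v) / v ^ 2) v =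
      ∫ v : ℂ, {v : ℂ | ε < ‖v‖}.indicator
        (fun v => (f (z + v) - f (z + Complex.I * v)) / v ^ 2) v := by
  let R : ℂ ≃ₗᵢ[ℝ] ℂ := rotation ⟨Complex.I, by simp [Submonoid.unitSphere]⟩
  have hR : ∀ v, R v = Complex.I * v := fun v => rotation_apply _ v
  have hmp := R.measurePreserving
  have hI := integrable_indicator_lt_norm_div_sq hf hs hε z
  have h1 := hmp.integral_comp R.toHomeomorph.measurableEmbedding
    ({v : ℂ | ε < ‖v‖}.indicator fun v => f (z + v) / v ^ 2)
  have hI2 := hmp.integrable_comp_of_integrable hI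
  simp only [Function.comp_def] at hI2
  rw [two_mul]
  nth_rewrite 2 [← h1]
  rw [← integral_add hI hI2]
  congr 1
  ext v
  simp only [indicator, mem_ofPred_eq, hR, norm_mul, Complex.norm_I, one_mul, mul_pow,
    Complex.I_sq]
  split_ifs
  · ring
  · ring

/-- `f` is Lipschitz, so the quotient is `O(1/|v|)`, locally integrable in the plane, and it
vanishes for large `v`. -/
theorem integrable_sub_rotation_div_sq {f : ℂ → ℂ} (hf : ContDiff ℝ ∞ f)
    (hs : HasCompactSupport f) (z : ℂ) :
    Integrable fun v : ℂ => (f (z + v) - f (z + Complex.I * v)) / v ^ 2 := by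
  obtain ⟨L, hL⟩ := hf.lipschitzWith_of_hasCompactSupport hs (by simp)
  have hm := hf.continuous.measurable
  have hloc : LocallyIntegrable (fun v : ℂ => (f (z + v) - f (z + Complex.I * v)) / v ^ 2) := by
    refine locallyIntegrable_of_norm_le_rpow (C := 2 * L) (α := 1) (by simp) (by simp)
      (ae_of_all _ fun v => ?_) (Measurable.aestronglyMeasurable (by fun_prop))
    have h1 := hL.dist_le_mul (z + v) (z + Complex.I * v)
    rw [dist_eq_norm, dist_eq_norm] at h1
    have h2 : ‖z + v - (z + Complex.I * v)‖ ≤ 2 * ‖v‖ := by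
      rw [add_sub_add_left_eq_sub]
      refine (norm_sub_le _ _).trans ?_
      rw [norm_mul, Complex.norm_I]
      linarith
    rw [norm_div, norm_pow, Real.rpow_neg_one]
    rcases eq_or_ne v 0 with rfl | hv
    · simp
    have hv' : 0 < ‖v‖ := norm_pos_iff.2 hv
    rw [div_le_iff₀ (by positivity)]
    calc _ ≤ L * (2 * ‖v‖) := h1.trans (by gcongr)
      _ = _ := by field_simp
  obtain ⟨ρ, hρ⟩ := hs.isCompact.isBounded.subset_closedBall z
  have hz : ∀ u : ℂ, ρ < ‖u‖ → f (z + u) = 0 := fun u hu => by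
    refine image_eq_zero_of_notMem_tsupport fun h => ?_
    have := hρ h
    simp [Metric.mem_closedBall, dist_eq_norm] at this
    linarith
  rw [← integrableOn_iff_integrable_of_support_subset (s := Metric.closedBall 0 ρ)]
  · exact hloc.integrableOn_isCompact (isCompact_closedBall _ _)
  · intro v hv
    by_contra h
    have hv' : ρ < ‖v‖ := by simpa using h
    refine hv ?_
    simp only
    rw [hz v hv', hz (Complex.I * v) (by simpa using hv')]
    simp

theorem tendsto_beurlingTrunc {f : ℂ → ℂ} (hf : IsTest f) (z : ℂ) :
    Tendsto (fun ε : ℝ => beurlingTrunc f ε z) (𝓝[>] (0 : ℝ)) (𝓝 (beurling f z)) := by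
  refine tendsto_nhds_limUnder ⟨-1 / (Real.pi : ℂ) * (1 / 2 *
    ∫ v : ℂ, (f (z + v) - f (z + Complex.I * v)) / v ^ 2), ?_⟩
  have hint := integrable_sub_rotation_div_sq hf.1 hf.2.1 z
  have h : Tendsto (fun ε : ℝ => ∫ v : ℂ, {v : ℂ | ε < ‖v‖}.indicator
      (fun v => (f (z + v) - f (z + Complex.I * v)) / v ^ 2) v) (𝓝[>] (0 : ℝ))
      (𝓝 (∫ v : ℂ, (f (z + v) - f (z + Complex.I * v)) / v ^ 2)) := by
    refine tendsto_integral_filter_of_dominated_convergence _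
      (Eventually.of_forall fun ε => hint.aestronglyMeasurable.indicator (measurableSet_lt_norm ε))
      (Eventually.of_forall fun ε => ae_of_all _ fun v => norm_indicator_le_norm_self _ _)
      hint.norm (ae_of_all _ fun v => ?_)
    refine tendsto_const_nhds.congr' ?_
    rcases eq_or_ne v 0 with rfl | hv
    · exact Eventually.of_forall fun ε => by simp [indicator]
    filter_upwards [Ioo_mem_nhdsGT (norm_pos_iff.2 hv)] with ε hε
    simp [indicator, hε.2]
  refine ((h.const_mul (1 / 2)).const_mul (-1 / (Real.pi : ℂ))).congr' ?_
  filter_upwards [self_mem_nhdsWithin] with ε hε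
  rw [beurlingTrunc_eq_integral_indicator hf,
    ← two_mul_integral_indicator_lt_norm hf.1.continuous hf.2.1 hε]
  ring

theorem beurling_eq_integral {f : ℂ → ℂ} (hf : IsTest f) {z : ℂ} {r : ℝ} (hr : 0 < r)
    (h : ∀ w, ‖w - z‖ < r → f w = 0) :
    beurling f z = -1 / (Real.pi : ℂ) * ∫ w, f w / (w - z) ^ 2 := by
  refine Tendsto.limUnder_eq (tendsto_const_nhds.congr' ?_)
  filter_upwards [Ioo_mem_nhdsGT hr] with ε hε
  rw [beurlingTrunc, setIntegral_eq_integral_of_forall_compl_eq_zero]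
  intro w hw
  by_cases h1 : w ∈ halfPlane
  · rw [h w ?_, zero_div]
    by_contra! h2
    exact hw ⟨h1, hε.2.trans_le h2⟩
  · rw [hf.eq_zero h1, zero_div]

/-! ### Thin layers and the limit of their Beurling transforms -/

/-- A smooth bump of integral `1` supported in `[1, 2]`. -/
def heightBump : ℝ → ℝ :=
  (⟨1 / 4, 1 / 2, by norm_num, by norm_num⟩ : ContDiffBump (3 / 2 : ℝ)).normed volume

theorem contDiff_heightBump : ContDiff ℝ ∞ heightBump := ContDiffBump.contDiff_normed _

theorem integral_heightBump : ∫ s, heightBump s = 1 := ContDiffBump.integral_normed _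

theorem heightBump_nonneg (s : ℝ) : 0 ≤ heightBump s := ContDiffBump.nonneg_normed _ _

theorem heightBump_eq_zero {s : ℝ} (hs : s ∉ Icc (1 : ℝ) 2) : heightBump s = 0 := by
  have h : s ∉ Function.support heightBump := by
    rw [heightBump, ContDiffBump.support_normed_eq]
    intro h
    rw [Metric.mem_ball, Real.dist_eq, abs_lt] at h
    exact hs ⟨by linarith [h.1], by linarith [h.2]⟩
  simpa using h

theorem hasCompactSupport_heightBump : HasCompactSupport heightBump :=
  HasCompactSupport.intro isCompact_Icc fun _ hs => heightBump_eq_zero hs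

/-- The function `g` spread over a layer at height comparable to `δ`. -/
def layer (g : ℝ → ℝ) (δ : ℝ) (w : ℂ) : ℂ := ((g w.re * (δ⁻¹ * heightBump (w.im / δ)) : ℝ) : ℂ)

theorem layer_eq_zero {g : ℝ → ℝ} (hs : ∀ x ∉ Icc (-2 : ℝ) 2, g x = 0) {δ : ℝ} (hδ : 0 < δ) {w : ℂ}
    (hw : w ∉ Icc (-2 : ℝ) 2 ×ℂ Icc δ (2 * δ)) : layer g δ w = 0 := by
  rw [Complex.mem_reProdIm, not_and_or] at hw
  rcases hw with h | h
  · simp [layer, hs _ h]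
  · rw [layer, heightBump_eq_zero]
    · simp
    · rintro ⟨h1, h2⟩
      rw [le_div_iff₀ hδ] at h1
      rw [div_le_iff₀ hδ] at h2
      exact h ⟨by linarith, h2⟩

theorem isTest_layer {g : ℝ → ℝ} (hg : ContDiff ℝ ∞ g) (hs : ∀ x ∉ Icc (-2 : ℝ) 2, g x = 0)
    {δ : ℝ} (hδ : 0 < δ) : IsTest (layer g δ) := by
  have hK : IsCompact (Icc (-2 : ℝ) 2 ×ℂ Icc δ (2 * δ)) := isCompact_Icc.reProdIm isCompact_Icc
  refine ⟨?_, HasCompactSupport.intro hK fun w hw => layer_eq_zero hs hδ hw, ?_⟩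
  · refine Complex.ofRealCLM.contDiff.comp ((hg.comp Complex.reCLM.contDiff).mul
      (contDiff_const.mul (contDiff_heightBump.comp ?_)))
    exact Complex.imCLM.contDiff.div_const δ
  · refine (closure_minimal (fun w hw => ?_) hK.isClosed).trans fun w hw => hδ.trans_le hw.2.1
    by_contra h
    exact hw (layer_eq_zero hs hδ h)

theorem sub_le_norm_sub_of_layer_ne_zero {g : ℝ → ℝ} (hs : ∀ x ∉ Icc (-2 : ℝ) 2, g x = 0) {δ : ℝ}
    (hδ : 0 < δ) {w : ℂ} (hw : layer g δ w ≠ 0) (z : ℂ) : z.im - 2 * δ ≤ ‖w - z‖ := by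
  have h : w ∈ Icc (-2 : ℝ) 2 ×ℂ Icc δ (2 * δ) := by
    by_contra h
    exact hw (layer_eq_zero hs hδ h)
  have h1 := Complex.abs_im_le_norm (w - z)
  have h2 := neg_abs_le (w - z).im
  rw [Complex.sub_im] at h1 h2
  linarith [h.2.2]

/-- The Beurling integral of `layer g δ`, without truncation. -/
def beurlingLayer (g : ℝ → ℝ) (δ : ℝ) (z : ℂ) : ℂ :=
  -1 / (Real.pi : ℂ) * ∫ w, layer g δ w / (w - z) ^ 2

theorem beurling_layer {g : ℝ → ℝ} (hg : ContDiff ℝ ∞ g) (hs : ∀ x ∉ Icc (-2 : ℝ) 2, g x = 0)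
    {δ : ℝ} (hδ : 0 < δ) {z : ℂ} (hz : 2 * δ < z.im) :
    beurling (layer g δ) z = beurlingLayer g δ z := by
  refine beurling_eq_integral (isTest_layer hg hs hδ) (r := z.im - 2 * δ) (by linarith)
    fun w hw => ?_
  by_contra h
  exact (sub_le_norm_sub_of_layer_ne_zero hs hδ h z).not_gt hw

theorem measurable_beurlingLayer {g : ℝ → ℝ} (hg : Continuous g) (δ : ℝ) :
    Measurable (beurlingLayer g δ) := by
  have : StronglyMeasurable (fun p : ℂ × ℂ => layer g δ p.2 / (p.2 - p.1) ^ 2) := by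
    refine Measurable.stronglyMeasurable ?_
    have := hg.measurable
    have := contDiff_heightBump.continuous.measurable
    unfold layer
    fun_prop
  exact (this.integral_prod_right'.measurable).const_mul _

/-- Fubini: the slice at height `t = δ s` contributes `cauchyDeriv g (z - i t)`. -/
theorem integral_layer_div_sq {g : ℝ → ℝ} (hg : ContDiff ℝ ∞ g)
    (hs : ∀ x ∉ Icc (-2 : ℝ) 2, g x = 0) {δ : ℝ} (hδ : 0 < δ) {z : ℂ} (hz : 2 * δ < z.im) :
    ∫ w, layer g δ w / (w - z) ^ 2 =
      ∫ s : ℝ, (heightBump s : ℂ) * cauchyDeriv g (z - (δ * s : ℝ) * Complex.I) := by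
  have hT := isTest_layer hg hs hδ
  have hi : Integrable fun w => layer g δ w / (w - z) ^ 2 := by
    refine Integrable.mono' ((hT.1.continuous.integrable_of_hasCompactSupport hT.2.1).norm.div_const
      ((z.im - 2 * δ) ^ 2)) ?_ (ae_of_all _ fun w => ?_)
    · have := hT.1.continuous.measurable
      exact Measurable.aestronglyMeasurable (by fun_prop)
    · rw [norm_div, norm_pow]
      by_cases hw : layer g δ w = 0
      · simp [hw]
      · have := sub_le_norm_sub_of_layer_ne_zero hs hδ hw z
        have h0 : 0 < z.im - 2 * δ := by linarith
        gcongr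
  have hmp := Complex.volume_preserving_equiv_real_prod.symm
  rw [← hmp.integral_comp' (f := Complex.measurableEquivRealProd.symm)]
  have hi' := hmp.integrable_comp_of_integrable hi
  simp only [Function.comp_def] at hi'
  rw [Measure.volume_eq_prod] at hi' ⊢
  rw [integral_prod_symm _ hi']
  have hsub := Measure.integral_comp_div
    (fun s : ℝ => (heightBump s : ℂ) * cauchyDeriv g (z - (δ * s : ℝ) * Complex.I)) δ
  rw [abs_of_pos hδ, Complex.real_smul] at hsub
  have hδ' : (δ : ℂ) ≠ 0 := by exact_mod_cast hδ.ne'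
  rw [← mul_right_inj' hδ', ← hsub, ← integral_const_mul]
  congr 1
  ext t
  rw [cauchyDeriv, ← integral_const_mul, ← integral_const_mul]
  congr 1
  ext y
  rw [Complex.measurableEquivRealProd_symm_apply, layer, mul_div_cancel₀ _ hδ.ne',
    show (y : ℂ) - (z - t * Complex.I) = ⟨y, t⟩ - z by rw [Complex.mk_eq_add_mul_I]; ring]
  push_cast
  field_simp

theorem norm_cauchyDeriv_le {g : ℝ → ℝ} (hg : Continuous g) (hs : HasCompactSupport g)
    {r : ℝ} (hr : 0 < r) {z : ℂ} (hz : r ≤ z.im) :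
    ‖cauchyDeriv g z‖ ≤ ∫ y, |g y| / r ^ 2 := by
  refine norm_integral_le_of_norm_le
    ((hg.abs.integrable_of_hasCompactSupport hs.abs).div_const _) (ae_of_all _ fun y => ?_)
  rw [norm_div, norm_pow, Complex.norm_real, Real.norm_eq_abs]
  have := hz.trans (im_le_norm_ofReal_sub z y)
  gcongr

theorem tendsto_beurlingLayer {g : ℝ → ℝ} (hg : ContDiff ℝ ∞ g)
    (hs : ∀ x ∉ Icc (-2 : ℝ) 2, g x = 0) {z : ℂ} (hz : 0 < z.im) :
    Tendsto (fun δ => beurlingLayer g δ z) (𝓝[>] 0)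
      (𝓝 (-1 / (Real.pi : ℂ) * cauchyDeriv g z)) := by
  have hcs := hasCompactSupport_of_eq_zero hs
  have hc := hg.continuous
  refine Tendsto.const_mul _ ?_
  -- Since `s ≤ 2` on the bump, the point `z - i δ s` then stays at height at least `z.im / 2`,
  -- which supplies the dominating function.
  have hev : ∀ᶠ δ : ℝ in 𝓝[>] 0, 0 < δ ∧ δ < z.im / 4 := Ioo_mem_nhdsGT (by linarith)
  have h : Tendsto
      (fun δ : ℝ => ∫ s : ℝ, (heightBump s : ℂ) * cauchyDeriv g (z - (δ * s : ℝ) * Complex.I))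
      (𝓝[>] 0) (𝓝 (∫ s : ℝ, (heightBump s : ℂ) * cauchyDeriv g z)) := by
    refine tendsto_integral_filter_of_dominated_convergence
      (fun s => heightBump s * ∫ y, |g y| / (z.im / 2) ^ 2) ?_ ?_ ?_ ?_
    · refine Eventually.of_forall fun δ => Measurable.aestronglyMeasurable ?_
      have h1 := contDiff_heightBump.continuous.measurable
      have h2 := measurable_cauchyDeriv hc
      fun_prop
    · filter_upwards [hev] with δ hδ
      refine ae_of_all _ fun s => ?_
      rw [norm_mul, Complex.norm_real, Real.norm_of_nonneg (heightBump_nonneg s)]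
      by_cases h : s ∈ Icc (1 : ℝ) 2
      · refine mul_le_mul_of_nonneg_left (norm_cauchyDeriv_le hc hcs (by linarith) ?_)
          (heightBump_nonneg s)
        simp only [Complex.sub_im, Complex.im_ofReal_mul, Complex.I_im, mul_one]
        nlinarith [h.2, hδ.1, hδ.2, h.1]
      · simp [heightBump_eq_zero h]
    · exact (contDiff_heightBump.continuous.integrable_of_hasCompactSupport
        hasCompactSupport_heightBump).mul_const _
    · refine ae_of_all _ fun s => Tendsto.const_mul _ ?_
      have h1 : ContinuousAt (cauchyDeriv g) z := (continuousOn_cauchyDeriv hc hcs).continuousAt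
        ((isOpen_lt continuous_const Complex.continuous_im).mem_nhds hz)
      have h2 : Tendsto (fun δ : ℝ => z - (δ * s : ℝ) * Complex.I) (𝓝[>] 0) (𝓝 z) := by
        have h3 : Continuous fun δ : ℝ => z - (δ * s : ℝ) * Complex.I := by fun_prop
        have h4 := h3.tendsto 0
        simp only [zero_mul, Complex.ofReal_zero, sub_zero] at h4
        exact h4.mono_left nhdsWithin_le_nhds
      exact h1.tendsto.comp h2
  rw [integral_mul_const, integral_complex_ofReal, integral_heightBump, Complex.ofReal_one,
    one_mul] at h
  refine h.congr' ?_
  filter_upwards [hev] with δ hδ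
  exact (integral_layer_div_sq hg hs hδ.1 (by linarith [hδ.2])).symm

/-! ### Carleson functionals and Whitney averages -/

theorem measurableSet_Ioo_reProdIm (a b c d : ℝ) : MeasurableSet (Ioo a b ×ℂ Ioo c d) :=
  (isOpen_Ioo.reProdIm isOpen_Ioo).measurableSet

theorem preimage_reProdIm (s t : Set ℝ) :
    Complex.measurableEquivRealProd.symm ⁻¹' (s ×ℂ t) = s ×ˢ t := by
  ext p
  simp [Complex.mem_reProdIm, Complex.measurableEquivRealProd_symm_apply]

theorem volume_reProdIm (s t : Set ℝ) : volume (s ×ℂ t) = volume s * volume t := by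
  rw [← Complex.volume_preserving_equiv_real_prod.symm.measure_preimage_equiv, preimage_reProdIm,
    Measure.volume_eq_prod, Measure.prod_prod]

theorem setLIntegral_reProdIm (s t : Set ℝ) {F : ℂ → ℝ≥0∞} (hF : Measurable F) :
    ∫⁻ z in s ×ℂ t, F z = ∫⁻ y in t, ∫⁻ x in s, F ⟨x, y⟩ := by
  rw [← Complex.volume_preserving_equiv_real_prod.symm.setLIntegral_comp_preimage_emb
    Complex.measurableEquivRealProd.symm.measurableEmbedding, preimage_reProdIm,
    Measure.volume_eq_prod, ← Measure.prod_restrict, lintegral_prod_symm]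
  · rfl
  · exact (hF.comp Complex.measurableEquivRealProd.symm.measurable).aemeasurable

theorem carleson_mono {F G : ℂ → ℝ≥0∞} (h : ∀ z, 0 < z.im → F z ≤ G z) (x : ℝ) :
    carleson F x ≤ carleson G x := by
  refine iSup_mono fun a => iSup_mono fun b => iSup_mono fun _ => ?_
  gcongr 1
  refine setLIntegral_mono' (measurableSet_Ioo_reProdIm _ _ _ _) fun z hz => h z hz.2.1

theorem lpNorm_mono {p : ℝ} (hp : 0 < p) {h k : ℝ → ℝ≥0∞} (hhk : ∀ x, h x ≤ k x) :
    lpNorm p h ≤ lpNorm p k := by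
  unfold lpNorm
  gcongr with x
  exact hhk x

theorem whitneyAverage_mono (q : ℝ) {F G : ℂ → ℂ} (h : ∀ z, ‖F z‖ ≤ ‖G z‖) (z : ℂ) :
    whitneyAverage q F z ≤ whitneyAverage q G z := by
  unfold whitneyAverage
  gcongr 1
  exact eLpNorm_mono h

theorem carlesonNorm_mono {p : ℝ} (hp : 0 < p) (q : ℝ) {F G : ℂ → ℂ} (h : ∀ z, ‖F z‖ ≤ ‖G z‖) :
    carlesonNorm p q F ≤ carlesonNorm p q G :=
  lpNorm_mono hp (carleson_mono fun z _ => whitneyAverage_mono q h z)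

/-- The interval contains `(0, 1)`, so its average bounds the supremum from below on a set of length
one. -/
theorem le_lpNorm_carleson {p : ℝ} (hp : 0 < p) (F : ℂ → ℝ≥0∞) {a b : ℝ} (ha : a ≤ 0)
    (hb : 1 ≤ b) :
    (ENNReal.ofReal (b - a))⁻¹ * ∫⁻ z in carlesonBox a b, F z ≤ lpNorm p (carleson F) := by
  set A := (ENNReal.ofReal (b - a))⁻¹ * ∫⁻ z in carlesonBox a b, F z with hA
  have h1 : A ^ p ≤ ∫⁻ x, carleson F x ^ p := by
    calc A ^ p = ∫⁻ _ in Ioo (0 : ℝ) 1, A ^ p := by simp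
      _ ≤ ∫⁻ x in Ioo (0 : ℝ) 1, carleson F x ^ p := by
        refine setLIntegral_mono' measurableSet_Ioo fun x hx => ?_
        gcongr
        exact le_iSup_of_le a (le_iSup_of_le b (le_iSup_of_le
          ⟨ha.trans_lt hx.1, hx.2.trans_le hb⟩ le_rfl))
      _ ≤ _ := setLIntegral_le_lintegral _ _
  calc A = (A ^ p) ^ (1 / p) := by
        rw [← ENNReal.rpow_mul, mul_one_div_cancel hp.ne', ENNReal.rpow_one]
    _ ≤ _ := by unfold lpNorm; gcongr

theorem volume_whitneyRegion {z : ℂ} (hz : 0 < z.im) :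
    volume (whitneyRegion z) = ENNReal.ofReal (z.im ^ 2 / 2) := by
  rw [whitneyRegion, volume_reProdIm, Real.volume_Ioo, Real.volume_Ioo,
    ← ENNReal.ofReal_mul (by linarith)]
  congr 1
  ring

theorem measurableSet_whitneyRegion (z : ℂ) : MeasurableSet (whitneyRegion z) :=
  measurableSet_Ioo_reProdIm _ _ _ _

theorem whitneyAverage_le {q : ℝ} (hq : 1 < q) {f : ℂ → ℂ} {B : ℝ} (hB : ∀ w, ‖f w‖ ≤ B)
    {z : ℂ} (hz : 0 < z.im) : whitneyAverage q f z ≤ ENNReal.ofReal B := by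
  have hV0 : volume (whitneyRegion z) ≠ 0 := by
    rw [volume_whitneyRegion hz]; simp; positivity
  have hVt : volume (whitneyRegion z) ≠ ⊤ := by rw [volume_whitneyRegion hz]; simp
  have h := eLpNorm_le_of_ae_bound (p := ENNReal.ofReal q)
    (μ := volume.restrict (whitneyRegion z)) (ae_of_all _ hB)
  rw [Measure.restrict_apply_univ, ENNReal.toReal_ofReal (by linarith)] at h
  calc whitneyAverage q f z
      ≤ volume (whitneyRegion z) ^ (-1 / q) *
        (volume (whitneyRegion z) ^ q⁻¹ * ENNReal.ofReal B) := by
        unfold whitneyAverage; gcongr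
    _ = ENNReal.ofReal B := by
        rw [← mul_assoc, ← ENNReal.rpow_add _ _ hV0 hVt, show -1 / q + q⁻¹ = 0 by ring,
          ENNReal.rpow_zero, one_mul]

theorem whitneyAverage_eq_zero (q : ℝ) {f : ℂ → ℂ} {z : ℂ} (h : ∀ w ∈ whitneyRegion z, f w = 0) :
    whitneyAverage q f z = 0 := by
  rw [whitneyAverage, eLpNorm_congr_ae (g := 0), eLpNorm_zero, mul_zero]
  exact (ae_restrict_mem (measurableSet_whitneyRegion z)).mono h

/-- Hölder's inequality on the Whitney region. -/
theorem average_le_whitneyAverage {q : ℝ} (hq : 1 < q) {F : ℂ → ℂ} (hF : Measurable F) {z : ℂ}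
    (hz : 0 < z.im) :
    (volume (whitneyRegion z))⁻¹ * ∫⁻ w in whitneyRegion z, ‖F w‖ₑ ≤ whitneyAverage q F z := by
  have hV0 : volume (whitneyRegion z) ≠ 0 := by
    rw [volume_whitneyRegion hz]; simp; positivity
  have hVt : volume (whitneyRegion z) ≠ ⊤ := by rw [volume_whitneyRegion hz]; simp
  have h := eLpNorm_le_eLpNorm_mul_rpow_measure_univ (p := 1) (q := ENNReal.ofReal q)
    (μ := volume.restrict (whitneyRegion z))
    (by rw [← ENNReal.ofReal_one]; exact ENNReal.ofReal_le_ofReal hq.le)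
    hF.aestronglyMeasurable
  rw [eLpNorm_one_eq_lintegral_enorm, Measure.restrict_apply_univ,
    ENNReal.toReal_ofReal (by linarith)] at h
  set V := volume (whitneyRegion z)
  calc _ ≤ V⁻¹ * (eLpNorm F (ENNReal.ofReal q) (volume.restrict (whitneyRegion z)) *
        V ^ (1 / (1 : ℝ≥0∞).toReal - 1 / q)) := by gcongr
    _ = (V ^ (-1 : ℝ) * V ^ (1 / (1 : ℝ≥0∞).toReal - 1 / q)) *
        eLpNorm F (ENNReal.ofReal q) (volume.restrict (whitneyRegion z)) := by
        rw [ENNReal.rpow_neg_one]; ring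
    _ = whitneyAverage q F z := by
        rw [← ENNReal.rpow_add _ _ hV0 hVt, whitneyAverage]
        congr 2
        simp
        ring

/-- A set of points `z` whose Whitney regions contain `w`. -/
def dualWhitneyRegion (w : ℂ) : Set ℂ :=
  Ioo (w.re - w.im / 2) (w.re + w.im / 2) ×ℂ Ioo w.im (2 * w.im)

theorem volume_dualWhitneyRegion {w : ℂ} (hw : 0 < w.im) :
    volume (dualWhitneyRegion w) = ENNReal.ofReal (w.im ^ 2) := by
  rw [dualWhitneyRegion, volume_reProdIm, Real.volume_Ioo, Real.volume_Ioo,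
    ← ENNReal.ofReal_mul (by linarith)]
  congr 1
  ring

theorem measurableSet_dualWhitneyRegion (w : ℂ) : MeasurableSet (dualWhitneyRegion w) :=
  measurableSet_Ioo_reProdIm _ _ _ _

theorem measurableSet_prod_dualWhitneyRegion :
    MeasurableSet {p : ℂ × ℂ | p.1 ∈ dualWhitneyRegion p.2} := by
  simp only [dualWhitneyRegion, Complex.mem_reProdIm, mem_Ioo]
  measurability

theorem mem_whitneyRegion_of_mem_dual {z w : ℂ} (h : z ∈ dualWhitneyRegion w) :
    w ∈ whitneyRegion z := by
  obtain ⟨⟨h1, h2⟩, h3, h4⟩ := h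
  exact ⟨⟨by linarith, by linarith⟩, by linarith, h3⟩

/-- The open unit square over `(0, 1)`. -/
def unitSquare : Set ℂ := Ioo 0 1 ×ℂ Ioo 0 1

theorem measurableSet_unitSquare : MeasurableSet unitSquare :=
  measurableSet_Ioo_reProdIm _ _ _ _

theorem dualWhitneyRegion_subset_carlesonBox {w : ℂ} (hw : w ∈ unitSquare) :
    dualWhitneyRegion w ⊆ carlesonBox (-1) 2 := by
  rintro z ⟨⟨h1, h2⟩, h3, h4⟩
  obtain ⟨⟨h5, h6⟩, h7, h8⟩ := hw
  exact ⟨⟨by linarith, by linarith⟩, by linarith, by linarith⟩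

/-- Tonelli with the kernel `1 / (2 (Im w)²)` on pairs with `z` in the dual region of `w`. There `Im
z < 2 Im w`, so the kernel is at most the reciprocal area `2 / (Im z)²` of the Whitney region; the
dual region has area `(Im w)²`, which leaves the factor `1/2`. -/
theorem half_lintegral_unitSquare_le {q : ℝ} (hq : 1 < q) {F : ℂ → ℂ} (hF : Measurable F) :
    2⁻¹ * ∫⁻ w in unitSquare, ‖F w‖ₑ ≤ ∫⁻ z in carlesonBox (-1) 2, whitneyAverage q F z := by
  let k : ℂ → ℂ → ℝ≥0∞ := fun z w => {p : ℂ × ℂ | p.1 ∈ dualWhitneyRegion p.2}.indicator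
    (fun p => (ENNReal.ofReal (2 * p.2.im ^ 2))⁻¹ * ‖F p.2‖ₑ) (z, w)
  have hk : Measurable (Function.uncurry k) := by
    refine Measurable.indicator ?_ measurableSet_prod_dualWhitneyRegion
    fun_prop
  have h1 : ∀ z ∈ carlesonBox (-1) 2, ∫⁻ w in unitSquare, k z w ≤ whitneyAverage q F z := by
    intro z hz
    have hz' : 0 < z.im := hz.2.1
    refine le_trans ?_ (average_le_whitneyAverage hq hF hz')
    rw [← lintegral_const_mul _ hF.enorm,
      ← lintegral_indicator measurableSet_unitSquare,
      ← lintegral_indicator (measurableSet_whitneyRegion z)]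
    refine lintegral_mono fun w => ?_
    by_cases hw : w ∈ unitSquare
    · rw [indicator_of_mem hw]
      by_cases hzw : z ∈ dualWhitneyRegion w
      · have hkz : k z w = (ENNReal.ofReal (2 * w.im ^ 2))⁻¹ * ‖F w‖ₑ :=
          indicator_of_mem (s := {p : ℂ × ℂ | p.1 ∈ dualWhitneyRegion p.2}) hzw _
        rw [indicator_of_mem (mem_whitneyRegion_of_mem_dual hzw), hkz,
          volume_whitneyRegion hz']
        gcongr
        have h4 : z.im < 2 * w.im := hzw.2.2
        nlinarith
      · have hkz : k z w = 0 :=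
          indicator_of_notMem (s := {p : ℂ × ℂ | p.1 ∈ dualWhitneyRegion p.2}) hzw _
        rw [hkz]
        exact zero_le
    · rw [indicator_of_notMem hw]
      exact zero_le
  calc 2⁻¹ * ∫⁻ w in unitSquare, ‖F w‖ₑ
      = ∫⁻ w in unitSquare, ∫⁻ z in carlesonBox (-1) 2, k z w := by
        rw [← lintegral_const_mul _ hF.enorm]
        refine setLIntegral_congr_fun measurableSet_unitSquare fun w hw => ?_
        have hw' : 0 < w.im := hw.2.1
        have hkz : (fun z => k z w) = (dualWhitneyRegion w).indicator
            fun _ => (ENNReal.ofReal (2 * w.im ^ 2))⁻¹ * ‖F w‖ₑ := rfl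
        rw [hkz, lintegral_indicator (measurableSet_dualWhitneyRegion w), setLIntegral_const,
          Measure.restrict_apply (measurableSet_dualWhitneyRegion w),
          inter_eq_left.2 (dualWhitneyRegion_subset_carlesonBox hw), volume_dualWhitneyRegion hw',
          mul_right_comm]
        congr 1
        rw [← ENNReal.ofReal_inv_of_pos (by positivity), ← ENNReal.ofReal_mul (by positivity)]
        rw [show (2 * w.im ^ 2)⁻¹ * w.im ^ 2 = 2⁻¹ by field_simp,
          ENNReal.ofReal_inv_of_pos two_pos]
        simp
    _ = ∫⁻ z in carlesonBox (-1) 2, ∫⁻ w in unitSquare, k z w :=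
        (lintegral_lintegral_swap hk.aemeasurable).symm
    _ ≤ _ := setLIntegral_mono' (measurableSet_Ioo_reProdIm _ _ _ _) h1

theorem lintegral_unitSquare_le_carlesonNorm {p q : ℝ} (hp : 0 < p) (hq : 1 < q) {F : ℂ → ℂ}
    (hF : Measurable F) : ∫⁻ w in unitSquare, ‖F w‖ₑ ≤ 6 * carlesonNorm p q F := by
  have h1 := le_lpNorm_carleson hp (whitneyAverage q F) (a := -1) (b := 2) (by norm_num)
    (by norm_num)
  have h2 := half_lintegral_unitSquare_le hq hF
  have h3 : ENNReal.ofReal (2 - -1) = 3 := by norm_num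
  rw [h3] at h1
  calc _ = 6 * (3⁻¹ * (2⁻¹ * ∫⁻ w in unitSquare, ‖F w‖ₑ)) := by
        rw [← mul_assoc, ← mul_assoc, show (6 : ℝ≥0∞) = 2 * 3 by norm_num, mul_assoc (2 : ℝ≥0∞),
          ENNReal.mul_inv_cancel (by norm_num) (by norm_num), mul_one,
          ENNReal.mul_inv_cancel (by norm_num) (by norm_num), one_mul]
    _ ≤ _ := by
        gcongr
        exact le_trans (by gcongr) h1

/-! ### Uniform Carleson bounds for layers -/

theorem exists_bound_heightBump : ∃ H : ℝ, 0 ≤ H ∧ ∀ s, heightBump s ≤ H := by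
  obtain ⟨H, hH⟩ := contDiff_heightBump.continuous.bounded_above_of_compact_support
    hasCompactSupport_heightBump
  refine ⟨H, (norm_nonneg _).trans (hH 0), fun s => (le_abs_self _).trans (hH s)⟩

theorem whitneyAverage_layer_le {q : ℝ} (hq : 1 < q) {g : ℝ → ℝ}
    (hs : ∀ x ∉ Icc (-2 : ℝ) 2, g x = 0) (hg : ∀ x, |g x| ≤ 2) {δ H : ℝ} (hδ : 0 < δ)
    (hδ1 : δ ≤ 1) (hH : ∀ s, heightBump s ≤ H) {z : ℂ} (hz : 0 < z.im) :
    whitneyAverage q (layer g δ) z ≤ (Ioo (-4 : ℝ) 4 ×ℂ Ioo δ (4 * δ)).indicator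
      (fun _ => ENNReal.ofReal (2 * H / δ)) z := by
  -- A Whitney region meeting the layer has `δ < Im z < 4δ`, and then `|Re z| < 2 + 2δ ≤ 4`.
  by_cases h : z ∈ Ioo (-4 : ℝ) 4 ×ℂ Ioo δ (4 * δ)
  · rw [indicator_of_mem h]
    refine whitneyAverage_le hq (fun w => ?_) hz
    rw [layer, Complex.norm_real, norm_mul, Real.norm_eq_abs,
      Real.norm_of_nonneg (mul_nonneg (inv_nonneg.2 hδ.le) (heightBump_nonneg _)),
      show 2 * H / δ = 2 * (δ⁻¹ * H) by ring]
    have := heightBump_nonneg (w.im / δ)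
    gcongr
    · exact hg _
    · exact hH _
  · rw [indicator_of_notMem h, whitneyAverage_eq_zero]
    rintro w ⟨⟨h1, h2⟩, h3, h4⟩
    refine layer_eq_zero hs hδ fun hw => h ?_
    obtain ⟨⟨h5, h6⟩, h7, h8⟩ := hw
    exact ⟨⟨by linarith, by linarith⟩, by linarith, by linarith⟩

theorem inv_mul_volume_inter_le {a b x : ℝ} (hx : x ∈ Ioo a b) :
    (ENNReal.ofReal (b - a))⁻¹ * volume (Ioo a b ∩ Ioo (-4 : ℝ) 4) ≤
      ENNReal.ofReal (13 / (1 + |x|)) := by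
  have hl : 0 < b - a := by linarith [hx.1, hx.2]
  rcases (Ioo a b ∩ Ioo (-4 : ℝ) 4).eq_empty_or_nonempty with h | ⟨y, ⟨h1, h2⟩, h3, h4⟩
  · simp [h]
  have hm : volume (Ioo a b ∩ Ioo (-4 : ℝ) 4) ≤ ENNReal.ofReal (min (b - a) 8) := by
    rw [ENNReal.ofReal_min, le_min_iff]
    constructor
    · exact (measure_mono inter_subset_left).trans_eq Real.volume_Ioo
    · refine (measure_mono inter_subset_right).trans_eq ?_
      rw [Real.volume_Ioo]; norm_num
  refine (mul_le_mul_right hm _).trans ?_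
  rw [← ENNReal.ofReal_inv_of_pos hl, ← ENNReal.ofReal_mul (by positivity)]
  refine ENNReal.ofReal_le_ofReal ?_
  have hxa : |x| ≤ 4 + (b - a) := abs_le.2 ⟨by linarith [hx.1, hx.2], by linarith [hx.1, hx.2]⟩
  -- With `ℓ = b - a`, `(1 + |x|) min(ℓ, 8) ≤ (5 + ℓ) min(ℓ, 8) ≤ 5ℓ + 8ℓ = 13ℓ`.
  rw [le_div_iff₀ (by positivity), inv_mul_eq_div, div_mul_eq_mul_div, div_le_iff₀ hl]
  have h5 : min (b - a) 8 ≤ b - a := min_le_left _ _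
  have h6 : min (b - a) 8 ≤ 8 := min_le_right _ _
  have h7 : 0 ≤ min (b - a) 8 := le_min hl.le (by norm_num)
  nlinarith

/-- The Whitney averages are at most `2H/δ` on a strip of thickness `3δ`, so each vertical line
carries mass at most `6H` whatever `δ` is; `78 = 13 · 6`. -/
theorem carleson_layer_le {q : ℝ} (hq : 1 < q) {g : ℝ → ℝ}
    (hs : ∀ x ∉ Icc (-2 : ℝ) 2, g x = 0) (hg : ∀ x, |g x| ≤ 2) {δ H : ℝ} (hδ : 0 < δ)
    (hδ1 : δ ≤ 1) (hH0 : 0 ≤ H) (hH : ∀ s, heightBump s ≤ H) (x : ℝ) :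
    carleson (whitneyAverage q (layer g δ)) x ≤ ENNReal.ofReal (78 * H / (1 + |x|)) := by
  refine iSup_le fun a => iSup_le fun b => iSup_le fun hx => ?_
  have h1 : ∫⁻ z in carlesonBox a b, whitneyAverage q (layer g δ) z ≤
      volume (Ioo a b ∩ Ioo (-4 : ℝ) 4) * ENNReal.ofReal (6 * H) := by
    have hms : MeasurableSet (Ioo (-4 : ℝ) 4 ×ℂ Ioo δ (4 * δ)) :=
      measurableSet_Ioo_reProdIm _ _ _ _
    calc _ ≤ ∫⁻ z in carlesonBox a b, (Ioo (-4 : ℝ) 4 ×ℂ Ioo δ (4 * δ)).indicator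
            (fun _ => ENNReal.ofReal (2 * H / δ)) z :=
          setLIntegral_mono' (measurableSet_Ioo_reProdIm _ _ _ _) fun z hz =>
            whitneyAverage_layer_le hq hs hg hδ hδ1 hH hz.2.1
      _ = ENNReal.ofReal (2 * H / δ) *
          volume ((Ioo (-4 : ℝ) 4 ×ℂ Ioo δ (4 * δ)) ∩ carlesonBox a b) := by
          rw [lintegral_indicator hms, setLIntegral_const, Measure.restrict_apply hms]
      _ ≤ ENNReal.ofReal (2 * H / δ) *
          volume ((Ioo a b ∩ Ioo (-4 : ℝ) 4) ×ℂ Ioo δ (4 * δ)) := by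
          gcongr
          rintro z ⟨⟨h1, h2⟩, h3, h4⟩
          exact ⟨⟨h3, h1⟩, h2⟩
      _ = _ := by
          rw [volume_reProdIm, Real.volume_Ioo, mul_left_comm,
            ← ENNReal.ofReal_mul (by positivity)]
          congr 2
          field_simp
          ring
  calc _ ≤ (ENNReal.ofReal (b - a))⁻¹ *
        (volume (Ioo a b ∩ Ioo (-4 : ℝ) 4) * ENNReal.ofReal (6 * H)) := by gcongr
    _ ≤ ENNReal.ofReal (13 / (1 + |x|)) * ENNReal.ofReal (6 * H) := by
        rw [← mul_assoc]
        gcongr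
        exact inv_mul_volume_inter_le hx
    _ = _ := by
        rw [← ENNReal.ofReal_mul (by positivity)]
        congr 1
        ring

theorem lpNorm_div_one_add_abs_ne_top {p : ℝ} (hp : 1 < p) {K : ℝ} (hK : 0 ≤ K) :
    lpNorm p (fun x => ENNReal.ofReal (K / (1 + |x|))) ≠ ⊤ := by
  refine ENNReal.rpow_ne_top_of_nonneg (by positivity) ?_
  have hi : Integrable fun x : ℝ => (1 + ‖x‖) ^ (-p) := integrable_one_add_norm (by simpa using hp)
  have h := (hi.const_mul (K ^ p)).lintegral_lt_top
  refine (lt_of_eq_of_lt (lintegral_congr fun x => ?_) h).ne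
  rw [ENNReal.ofReal_rpow_of_nonneg (by positivity) (by linarith), Real.div_rpow hK (by positivity),
    Real.rpow_neg (by positivity), Real.norm_eq_abs]
  rfl

/-- The layers over functions bounded by `2` and supported in `[-2, 2]` are uniformly bounded in
the Carleson norm. -/
theorem exists_carlesonNorm_layer_le {p q : ℝ} (hp : 1 < p) (hq : 1 < q) :
    ∃ C : ℝ≥0∞, C ≠ ⊤ ∧ ∀ g : ℝ → ℝ, (∀ x ∉ Icc (-2 : ℝ) 2, g x = 0) → (∀ x, |g x| ≤ 2) →
      ∀ δ : ℝ, 0 < δ → δ ≤ 1 → carlesonNorm p q (layer g δ) ≤ C := by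
  obtain ⟨H, hH0, hH⟩ := exists_bound_heightBump
  exact ⟨_, lpNorm_div_one_add_abs_ne_top hp (show 0 ≤ 78 * H by positivity),
    fun g hs hg δ hδ hδ1 => lpNorm_mono (by linarith)
      fun x => carleson_layer_le hq hs hg hδ hδ1 hH0 hH x⟩

/-! ### Domination of the variation by the functionals -/

theorem poissonVariation_eq_setLIntegral {g : ℝ → ℝ} (hg : Continuous g) :
    poissonVariation g 0 1 = ∫⁻ z in unitSquare, ‖1 / Real.pi * (cauchyDeriv g z).re‖ₑ :=
  (setLIntegral_reProdIm _ _ (measurable_enorm_re_cauchyDeriv hg)).symm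

theorem poissonVariation_eq_lintegral_poissonDtL1 {g : ℝ → ℝ} (hg : Continuous g)
    (hs : HasCompactSupport g) :
    poissonVariation g 0 1 = ∫⁻ t in Ioo (0 : ℝ) 1, poissonDtL1 g t :=
  setLIntegral_congr_fun measurableSet_Ioo fun t ht => by
    simp only [poissonDtL1, poissonDt_eq hg hs _ ht.1]

theorem carlesonBox_zero_one : carlesonBox 0 1 = unitSquare := by
  simp [carlesonBox, unitSquare]

theorem lintegral_unitSquare_le_lpNorm_carleson {p : ℝ} (hp : 0 < p) (F : ℂ → ℝ≥0∞) :
    ∫⁻ z in unitSquare, F z ≤ lpNorm p (carleson F) := by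
  simpa [carlesonBox_zero_one] using le_lpNorm_carleson hp F (le_refl 0) (le_refl 1)

theorem poissonVariation_le_lpNorm_carleson_gradient {p : ℝ} (hp : 0 < p) {g : ℝ → ℝ}
    (hg : Continuous g) (hs : HasCompactSupport g) :
    poissonVariation g 0 1 ≤ lpNorm p (carleson fun z => ‖gradient (poisson g) z‖ₑ) := by
  rw [poissonVariation_eq_setLIntegral hg]
  refine le_trans ?_ (lintegral_unitSquare_le_lpNorm_carleson hp _)
  exact setLIntegral_mono' measurableSet_unitSquare fun z hz =>
    enorm_poissonDt_le_gradient hg hs hz.2.1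

/-- The Beurling transform of `layer g δ`, restricted to the region above the layer. -/
def beurlingAbove (g : ℝ → ℝ) (δ : ℝ) : ℂ → ℂ :=
  {z : ℂ | 2 * δ < z.im}.indicator (beurlingLayer g δ)

theorem measurable_beurlingAbove {g : ℝ → ℝ} (hg : Continuous g) (δ : ℝ) :
    Measurable (beurlingAbove g δ) :=
  (measurable_beurlingLayer hg δ).indicator
    (measurableSet_lt measurable_const Complex.measurable_im)

/-- Discarding the region up to the top of the layer leaves a minorant given by an absolutely
convergent integral, hence visibly measurable. -/
theorem norm_beurlingAbove_le {g : ℝ → ℝ} (hg : ContDiff ℝ ∞ g)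
    (hs : ∀ x ∉ Icc (-2 : ℝ) 2, g x = 0) {δ : ℝ} (hδ : 0 < δ) (z : ℂ) :
    ‖beurlingAbove g δ z‖ ≤ ‖beurling (layer g δ) z‖ := by
  by_cases hz : z ∈ {z : ℂ | 2 * δ < z.im}
  · rw [beurlingAbove, indicator_of_mem hz, beurling_layer hg hs hδ hz]
  · rw [beurlingAbove, indicator_of_notMem hz, norm_zero]
    exact norm_nonneg _

theorem tendsto_beurlingAbove {g : ℝ → ℝ} (hg : ContDiff ℝ ∞ g)
    (hs : ∀ x ∉ Icc (-2 : ℝ) 2, g x = 0) {z : ℂ} (hz : 0 < z.im) :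
    Tendsto (fun δ => beurlingAbove g δ z) (𝓝[>] 0)
      (𝓝 (-1 / (Real.pi : ℂ) * cauchyDeriv g z)) := by
  refine (tendsto_beurlingLayer hg hs hz).congr' ?_
  filter_upwards [Ioo_mem_nhdsGT (show 0 < z.im / 2 by linarith)] with δ hδ
  rw [beurlingAbove, indicator_of_mem]
  simp only [mem_ofPred_eq]
  linarith [hδ.2]

/-- Fatou's lemma along `δ = 1/(n+1)`, with the real part bounded by the modulus. -/
theorem poissonVariation_le_of_beurlingAbove {g : ℝ → ℝ} (hg : ContDiff ℝ ∞ g)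
    (hs : ∀ x ∉ Icc (-2 : ℝ) 2, g x = 0) {A : ℝ≥0∞}
    (hA : ∀ δ : ℝ, 0 < δ → δ ≤ 1 → ∫⁻ z in unitSquare, ‖beurlingAbove g δ z‖ₑ ≤ A) :
    poissonVariation g 0 1 ≤ A := by
  let d : ℕ → ℝ := fun n => 1 / ((n : ℝ) + 1)
  have hd0 : ∀ n, 0 < d n := fun n => Nat.one_div_pos_of_nat
  have hd1 : ∀ n, d n ≤ 1 := fun n => by
    simp only [d]
    rw [div_le_one (by positivity)]
    linarith [(Nat.cast_nonneg n : (0 : ℝ) ≤ n)]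
  have hd : Tendsto d atTop (𝓝[>] 0) := tendsto_nhdsWithin_iff.2
    ⟨tendsto_one_div_add_atTop_nhds_zero_nat, Eventually.of_forall hd0⟩
  rw [poissonVariation_eq_setLIntegral hg.continuous]
  calc ∫⁻ z in unitSquare, ‖1 / Real.pi * (cauchyDeriv g z).re‖ₑ
      ≤ ∫⁻ z in unitSquare, liminf (fun n => ‖beurlingAbove g (d n) z‖ₑ) atTop := by
        refine setLIntegral_mono' measurableSet_unitSquare fun z hz => ?_
        have ht : Tendsto (fun n => ‖beurlingAbove g (d n) z‖ₑ) atTop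
            (𝓝 ‖-1 / (Real.pi : ℂ) * cauchyDeriv g z‖ₑ) :=
          ((tendsto_beurlingAbove hg hs hz.2.1).comp hd).enorm
        rw [ht.liminf_eq, enorm_mul, enorm_mul]
        gcongr ?_ * ?_
        · rw [enorm_le_iff_norm_le]; simp
        · rw [enorm_le_iff_norm_le]; exact Complex.abs_re_le_norm _
    _ ≤ liminf (fun n => ∫⁻ z in unitSquare, ‖beurlingAbove g (d n) z‖ₑ) atTop :=
        lintegral_liminf_le fun n => (measurable_beurlingAbove hg.continuous _).enorm
    _ ≤ A := liminf_le_of_frequently_le'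
        (Frequently.of_forall fun n => hA (d n) (hd0 n) (hd1 n))

/-! ### Failure of the estimates -/

theorem not_forall_poissonVariation_le {A : ℝ≥0∞} (hA : A ≠ ⊤) :
    ¬ ∀ g : ℝ → ℝ, ContDiff ℝ ∞ g → (∀ x ∉ Icc (-2 : ℝ) 2, g x = 0) → (∀ x, |g x| ≤ 2) →
      poissonVariation g 0 1 ≤ A := by
  intro h
  obtain ⟨g, hg, hs, hb, hM⟩ := exists_large_poissonVariation (A.toNNReal + 1)
  have h1 := hM.trans (h g hg hs hb)
  rw [ENNReal.coe_add, ENNReal.coe_toNNReal hA] at h1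
  exact (ENNReal.lt_add_right hA one_ne_zero).not_ge h1

theorem exists_lpNorm_le {p : ℝ} (hp : 1 < p) :
    ∃ C : ℝ≥0∞, C ≠ ⊤ ∧ ∀ g : ℝ → ℝ, (∀ x ∉ Icc (-2 : ℝ) 2, g x = 0) → (∀ x, |g x| ≤ 2) →
      lpNorm p (fun x => ‖g x‖ₑ) ≤ C := by
  refine ⟨lpNorm p (fun x => ENNReal.ofReal (6 / (1 + |x|))),
    lpNorm_div_one_add_abs_ne_top hp (by norm_num), fun g hs hb =>
      lpNorm_mono (by linarith) fun x => ?_⟩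
  rw [Real.enorm_eq_ofReal_abs]
  refine ENNReal.ofReal_le_ofReal ?_
  by_cases hx : x ∈ Icc (-2 : ℝ) 2
  · rw [le_div_iff₀ (by positivity)]
    have := abs_le.2 hx
    nlinarith [hb x, abs_nonneg (g x), abs_nonneg x]
  · rw [hs x hx, abs_zero]
    positivity

theorem not_carlesonNorm_beurling_le {p q : ℝ} (hp : 1 < p) (hq : 1 < q) :
    ¬ ∃ c : ℝ≥0, ∀ f : ℂ → ℂ, IsTest f →
      carlesonNorm p q (beurling f) ≤ c * carlesonNorm p q f := by
  rintro ⟨c, hc⟩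
  obtain ⟨C, hC, hCb⟩ := exists_carlesonNorm_layer_le hp hq
  refine not_forall_poissonVariation_le (A := 6 * (c * C))
    (ENNReal.mul_ne_top (by norm_num) (ENNReal.mul_ne_top ENNReal.coe_ne_top hC))
    fun g hg hs hb => poissonVariation_le_of_beurlingAbove hg hs fun δ hδ hδ1 => ?_
  refine (lintegral_unitSquare_le_carlesonNorm (p := p) (by linarith) hq
    (measurable_beurlingAbove hg.continuous δ)).trans ?_
  gcongr
  exact (carlesonNorm_mono (by linarith) q (norm_beurlingAbove_le hg hs hδ)).trans
    ((hc _ (isTest_layer hg hs hδ)).trans (by gcongr; exact hCb g hs hb δ hδ hδ1))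

theorem not_lpNorm_carleson_beurling_le {p q : ℝ} (hp : 1 < p) (hq : 1 < q) :
    ¬ ∃ c : ℝ≥0, ∀ f : ℂ → ℂ, IsTest f →
      lpNorm p (carleson fun z => ‖beurling f z‖ₑ) ≤ c * carlesonNorm p q f := by
  rintro ⟨c, hc⟩
  obtain ⟨C, hC, hCb⟩ := exists_carlesonNorm_layer_le hp hq
  refine not_forall_poissonVariation_le (A := c * C) (ENNReal.mul_ne_top ENNReal.coe_ne_top hC)
    fun g hg hs hb => poissonVariation_le_of_beurlingAbove hg hs fun δ hδ hδ1 => ?_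
  refine (lintegral_mono fun z => enorm_le_iff_norm_le.2 (norm_beurlingAbove_le hg hs hδ z)).trans ?_
  refine (lintegral_unitSquare_le_lpNorm_carleson (p := p) (by linarith) _).trans ?_
  exact (hc _ (isTest_layer hg hs hδ)).trans (by gcongr; exact hCb g hs hb δ hδ hδ1)

/-- No functional dominating the variation over the unit square is bounded on `L_p`. -/
theorem not_le_lpNorm_of_poissonVariation_le {p : ℝ} (hp : 1 < p) {Φ : (ℝ → ℝ) → ℝ≥0∞}
    (hΦ : ∀ g : ℝ → ℝ, Continuous g → HasCompactSupport g → poissonVariation g 0 1 ≤ Φ g) :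
    ¬ ∃ c : ℝ≥0, ∀ g : ℝ → ℝ, ContDiff ℝ ∞ g → HasCompactSupport g →
      Φ g ≤ c * lpNorm p fun x => ‖g x‖ₑ := by
  rintro ⟨c, hc⟩
  obtain ⟨C, hC, hCb⟩ := exists_lpNorm_le hp
  refine not_forall_poissonVariation_le (A := c * C) (ENNReal.mul_ne_top ENNReal.coe_ne_top hC)
    fun g hg hs hb => ?_
  have hcs := hasCompactSupport_of_eq_zero hs
  exact (hΦ g hg.continuous hcs).trans
    ((hc g hg hcs).trans (by gcongr; exact hCb g hs hb))

end BeurlingCarleson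

end

/-- The principal value converges on test functions, and for all `1 < p, q < ∞` none of the following
estimates holds with a finite constant, already for test functions. -/
theorem mainTheorem4 :
    (∀ f : ℂ → ℂ, BeurlingCarleson.IsTest f → ∀ z ∈ BeurlingCarleson.halfPlane,
      Filter.Tendsto (fun ε : ℝ => BeurlingCarleson.beurlingTrunc f ε z) (𝓝[>] (0 : ℝ))
        (𝓝 (BeurlingCarleson.beurling f z))) ∧
    ∀ p q : ℝ, 1 < p → 1 < q →
      -- `‖C(W_q(Sf))‖_p ≲ ‖C(W_q f)‖_p` fails
      (¬ ∃ c : ℝ≥0, ∀ f : ℂ → ℂ, BeurlingCarleson.IsTest f →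
        BeurlingCarleson.carlesonNorm p q (BeurlingCarleson.beurling f) ≤
          c * BeurlingCarleson.carlesonNorm p q f) ∧
      -- `‖C(Sf)‖_p ≲ ‖C(W_q f)‖_p` fails
      (¬ ∃ c : ℝ≥0, ∀ f : ℂ → ℂ, BeurlingCarleson.IsTest f →
        BeurlingCarleson.lpNorm p
            (BeurlingCarleson.carleson fun z => ‖BeurlingCarleson.beurling f z‖ₑ) ≤
          c * BeurlingCarleson.carlesonNorm p q f) ∧
      -- `‖C(∇u)‖_p ≲ ‖g‖_p` fails
      (¬ ∃ c : ℝ≥0, ∀ g : ℝ → ℝ, ContDiff ℝ ∞ g → HasCompactSupport g →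
        BeurlingCarleson.lpNorm p
            (BeurlingCarleson.carleson fun z => ‖gradient (BeurlingCarleson.poisson g) z‖ₑ) ≤
          c * BeurlingCarleson.lpNorm p fun x => ‖g x‖ₑ) ∧
      -- `∫₀¹ ‖∂_t u(t, ·)‖_{L_1(0,1)} dt ≲ ‖g‖_p` fails
      (¬ ∃ c : ℝ≥0, ∀ g : ℝ → ℝ, ContDiff ℝ ∞ g → HasCompactSupport g →
        (∫⁻ t in Set.Ioo (0 : ℝ) 1, BeurlingCarleson.poissonDtL1 g t) ≤
          c * BeurlingCarleson.lpNorm p fun x => ‖g x‖ₑ) ∧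
      -- `∫₀¹ max_k ‖∂_t u_k(t, ·)‖_{L_1(0,1)} dt ≲ ‖(∑_k |g_k|²)^{1/2}‖_p` fails
      (¬ ∃ c : ℝ≥0, ∀ (K : ℕ) (g : Fin K → ℝ → ℝ),
        (∀ k, ContDiff ℝ ∞ (g k) ∧ HasCompactSupport (g k)) →
        (∫⁻ t in Set.Ioo (0 : ℝ) 1, ⨆ k, BeurlingCarleson.poissonDtL1 (g k) t) ≤
          c * BeurlingCarleson.lpNorm p fun x => ‖√(∑ k, g k x ^ 2)‖ₑ) := by
  refine ⟨fun f hf z _ => BeurlingCarleson.tendsto_beurlingTrunc hf z, fun p q hp hq =>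
    ⟨BeurlingCarleson.not_carlesonNorm_beurling_le hp hq,
      BeurlingCarleson.not_lpNorm_carleson_beurling_le hp hq,
      BeurlingCarleson.not_le_lpNorm_of_poissonVariation_le hp fun g hg hs =>
        BeurlingCarleson.poissonVariation_le_lpNorm_carleson_gradient (by linarith) hg hs,
      BeurlingCarleson.not_le_lpNorm_of_poissonVariation_le hp fun g hg hs =>
        (BeurlingCarleson.poissonVariation_eq_lintegral_poissonDtL1 hg hs).le, ?_⟩⟩
  rintro ⟨c, hc⟩
  refine BeurlingCarleson.not_le_lpNorm_of_poissonVariation_le hp (fun g hg hs =>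
    (BeurlingCarleson.poissonVariation_eq_lintegral_poissonDtL1 hg hs).le)
    ⟨c, fun g hg hs => ?_⟩
  -- A family with a single member turns the square function estimate into the scalar one.
  have h := hc 1 (fun _ => g) fun _ => ⟨hg, hs⟩
  simpa [Real.sqrt_sq_eq_abs] using h
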